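/- Let $H$ be a compact convex subset of $\mathbb{R}^2$ with non-empty interior. For such a set $K$, let $Q^n_K$ be the probability that $n$ independent random points, each uniformly distributed on $K$, are in convex position, i.e. are the $n$ vertices of a convex polygon. Let $x_{\min}$ and $x_{\max}$ be the minimum and maximum of the abscissas of the points of $H$ and, for $x\in[x_{\min},x_{\max}]$, let $$W_H(x)=\sup\{y:(x,y)\in H\}-\inf\{y:(x,y)\in H\}$$ be the length of the vertical section of $H$ at abscissa $x$. Let $$H^{\mathsf{Sym}}=\{(x,y): x_{\min}\le x\le x_{\max},\ |y|\le W_H(x)/2\},\qquad H^{\mathsf{Sha}}=\{(x,y): x_{\min}\le x\le x_{\max},\ 0\le y\le W_H(x)\}$$ be the sets obtained from $H$ by Steiner symmetrization and by shaking with respect to the $x$-axis. Then, for $n=4$ and for $n=5$, $$Q^n_{H^{\mathsf{Sym}}}\ge Q^n_H\qquad\text{and}\qquad Q^n_{H^{\mathsf{Sha}}}\le Q^n_H .$$ -/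

import Mathlib

open MeasureTheory ProbabilityTheory

noncomputable section

/-- `CCS`: the compact convex subsets of the plane with non-empty interior. The plane is `ℝ × ℝ`,
whose `volume` is the two-dimensional Lebesgue measure. -/
def IsCCS (H : Set (ℝ × ℝ)) : Prop :=
  IsCompact H ∧ Convex ℝ H ∧ (interior H).Nonempty

/-- The `n`-tuples of points of the plane in convex position: no point of the tuple lies in the
convex hull of the others, i.e. the `n` points are the `n` vertices of a convex polygon. -/
def convexPosition (n : ℕ) : Set (Fin n → ℝ × ℝ) :=
  {z | ConvexIndependent ℝ z}

/-- The law of `n` independent points taken under the uniform distribution over `H`. -/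
def uniformLaw (H : Set (ℝ × ℝ)) (n : ℕ) : Measure (Fin n → ℝ × ℝ) :=
  Measure.pi fun _ => cond volume H

/-- `Q^n_H`: the probability that `n` independent uniform points of `H` are in convex position. -/
def Q (n : ℕ) (H : Set (ℝ × ℝ)) : ℝ :=
  (uniformLaw H n).real (convexPosition n)

/-- The minimum abscissa of `H`. -/
def xMin (H : Set (ℝ × ℝ)) : ℝ := sInf (Prod.fst '' H)

/-- The maximum abscissa of `H`. -/
def xMax (H : Set (ℝ × ℝ)) : ℝ := sSup (Prod.fst '' H)

/-- The lowest ordinate of `H` at abscissa `x`. -/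
def yLow (H : Set (ℝ × ℝ)) (x : ℝ) : ℝ := sInf {y | (x, y) ∈ H}

/-- The highest ordinate of `H` at abscissa `x`. -/
def yHigh (H : Set (ℝ × ℝ)) (x : ℝ) : ℝ := sSup {y | (x, y) ∈ H}

/-- The width function of `H`, zero outside `[xMin H, xMax H]`. -/
def width (H : Set (ℝ × ℝ)) : ℝ → ℝ :=
  (Set.Icc (xMin H) (xMax H)).indicator fun x => yHigh H x - yLow H x

/-- Steiner symmetrization of `H` with respect to the `x`-axis. -/
def steinerSymm (H : Set (ℝ × ℝ)) : Set (ℝ × ℝ) :=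
  {p | xMin H ≤ p.1 ∧ p.1 ≤ xMax H ∧ |p.2| ≤ width H p.1 / 2}

/-- Shaking of `H` with respect to the `x`-axis. -/
def shaking (H : Set (ℝ × ℝ)) : Set (ℝ × ℝ) :=
  {p | xMin H ≤ p.1 ∧ p.1 ≤ xMax H ∧ 0 ≤ p.2 ∧ p.2 ≤ width H p.1}

end

/-!
Let `orient a b c` be twice the signed area of the triangle `a b c`, and let `A` be the area of a
convex set `K`.

*Reduction to triangle areas.* Among four points in general position at most one lies in the
triangle of the others, so `Q 4 K = 1 - 4 E|orient| / (2 A)` (`Q_four`). Among five, let `T` count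
the pairs formed by a quadruple and one of its points lying in the triangle of the other three, and
let `U` count the ordered pairs of points which both lie in the triangle of the remaining three.
According as the hull has five, four or three vertices, `(T, U)` is `(0, 0)`, `(2, 0)` or `(4, 2)`,
so that the indicator of convex position is `1 - T / 2 + U / 2`, whence
`Q 5 K = 1 - 10 E[|orient| / (2 A)] + 10 E[(|orient| / (2 A)) ^ 2]` (`Q_five`). Both are
decreasing affine functions of `E[|orient| - κ orient ^ 2]`, with `κ = 0` and `κ = 1 / (2 A)`.

*Conditioning on the abscissas.* The three sets `steinerSymm H`, `H` and `shaking H` are images of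
the first one under the area-preserving vertical shears by `0`, by the middle ordinate of `H` and by
half its width. Given the abscissas, the three ordinates in `steinerSymm H` are independent and
uniform on centred intervals, and `orient = S + d`, where `S` is linear in the ordinates and the
offset `d` depends only on the shear. The offset is `0` for `steinerSymm H` and is largest in
absolute value for `shaking H` (`abs_sum_midOrdinate_le`), by convexity.

*The conditional expectation is quadratic in the offset.* Let `m` be the index of the middle
abscissa, `a` its coefficient in `S` and `w` the width there. Convexity makes the contribution of the
`m`-th ordinate so dominant that `S + d` vanishes somewhere along its interval, for every choice of
the two other ordinates. Integrating over that ordinate therefore gives a quadratic polynomial of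
the rest, and the conditional expectation is `const + (1 / (|a| w) - κ) d ^ 2`
(`integral_pi_absSubSq`). Finally `|a| w ≤ 2 A`, since `H` contains two triangles on the middle chord
(`sub_mul_width_le`), so the coefficient of `d ^ 2` is nonnegative.
-/

/-! ### Orientation of triples -/

/-- Twice the signed area of the triangle `a b c`. -/
def orient (a b c : ℝ × ℝ) : ℝ :=
  (b.1 - a.1) * (c.2 - a.2) - (b.2 - a.2) * (c.1 - a.1)

/-- `p` sees the three oriented sides of the triangle `a b c` under the same weak orientation.
For a nondegenerate triangle this means that `p` lies in the closed triangle. -/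
def InTri (p a b c : ℝ × ℝ) : Prop :=
  (0 ≤ orient p a b ∧ 0 ≤ orient p b c ∧ 0 ≤ orient p c a) ∨
    (orient p a b ≤ 0 ∧ orient p b c ≤ 0 ∧ orient p c a ≤ 0)

/-- A tuple of points is in general position if no three of its points are collinear. -/
def GenPos {n : ℕ} (z : Fin n → ℝ × ℝ) : Prop :=
  ∀ i j k, i ≠ j → i ≠ k → j ≠ k → orient (z i) (z j) (z k) ≠ 0

theorem orient_swap_left (a b c : ℝ × ℝ) : orient b a c = -orient a b c := by
  unfold orient; ring

theorem orient_swap_right (a b c : ℝ × ℝ) : orient a c b = -orient a b c := by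
  unfold orient; ring

theorem orient_rotate (a b c : ℝ × ℝ) : orient b c a = orient a b c := by
  unfold orient; ring

theorem orient_add_orient_add_orient (p a b c : ℝ × ℝ) :
    orient p a b + orient p b c + orient p c a = orient a b c := by
  unfold orient; ring

/-- The barycentric coordinates of `p` with respect to `a b c`, without denominators. -/
theorem orient_smul_eq (p a b c : ℝ × ℝ) :
    orient a b c • p = orient p b c • a + orient p c a • b + orient p a b • c := by
  unfold orient
  ext <;> simp <;> ring

theorem convex_setOf_orient_nonneg (a b : ℝ × ℝ) : Convex ℝ {p | 0 ≤ orient p a b} := by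
  intro p hp q hq s t hs ht hst
  simp only [Set.mem_ofPred_eq] at *
  have : orient (s • p + t • q) a b = s * orient p a b + t * orient q a b := by
    obtain rfl : t = 1 - s := by linarith
    simp only [orient, Prod.fst_add, Prod.snd_add, Prod.smul_fst, Prod.smul_snd, smul_eq_mul]
    ring
  rw [this]
  positivity

theorem inTri_swap {p a b c : ℝ × ℝ} (h : InTri p a b c) : InTri p a c b := by
  unfold InTri at *
  rw [orient_swap_right p c a, orient_swap_right p b c, orient_swap_right p a b]
  rcases h with ⟨h1, h2, h3⟩ | ⟨h1, h2, h3⟩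
  · right; refine ⟨?_, ?_, ?_⟩ <;> linarith
  · left; refine ⟨?_, ?_, ?_⟩ <;> linarith

theorem inTri_swap_iff {p a b c : ℝ × ℝ} : InTri p a c b ↔ InTri p a b c :=
  ⟨inTri_swap, inTri_swap⟩

theorem inTri_iff_of_pos {a b c : ℝ × ℝ} (h : 0 < orient a b c) (p : ℝ × ℝ) :
    InTri p a b c ↔ 0 ≤ orient p a b ∧ 0 ≤ orient p b c ∧ 0 ≤ orient p c a := by
  refine ⟨fun hp => ?_, Or.inl⟩
  rcases hp with hp | ⟨h1, h2, h3⟩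
  · exact hp
  · have := orient_add_orient_add_orient p a b c
    linarith

theorem setOf_inTri_eq_convexHull_of_pos {a b c : ℝ × ℝ} (h : 0 < orient a b c) :
    {p | InTri p a b c} = convexHull ℝ {a, b, c} := by
  apply Set.Subset.antisymm
  · intro p hp
    obtain ⟨h1, h2, h3⟩ := (inTri_iff_of_pos h p).1 hp
    have hp' : p = (orient p b c / orient a b c) • a + (orient p c a / orient a b c) • b
        + (orient p a b / orient a b c) • c := by
      have := orient_smul_eq p a b c
      apply smul_right_injective _ h.ne'
      simp only [smul_add, smul_smul, mul_div_cancel₀ _ h.ne']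
      exact this
    rw [hp']
    have key := (convex_convexHull ℝ {a, b, c}).sum_mem (t := Finset.univ)
      (w := ![orient p b c / orient a b c, orient p c a / orient a b c,
        orient p a b / orient a b c]) (z := ![a, b, c]) ?_ ?_ ?_
    · simpa [Fin.sum_univ_three] using key
    · intro i _; fin_cases i <;> simp <;> positivity
    · simp only [Fin.sum_univ_three, Matrix.cons_val_zero, Matrix.cons_val_one, Matrix.cons_val]
      rw [← add_div, ← add_div, div_eq_one_iff_eq h.ne']
      linarith [orient_add_orient_add_orient p a b c]
    · intro i _; apply subset_convexHull; fin_cases i <;> simp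
  · have heq : {p | InTri p a b c} =
        {p | 0 ≤ orient p a b} ∩ ({p | 0 ≤ orient p b c} ∩ {p | 0 ≤ orient p c a}) := by
      ext p; exact inTri_iff_of_pos h p
    apply convexHull_min
    · rintro p (rfl | rfl | rfl) <;>
        simp only [Set.mem_ofPred_eq] <;> left <;> simp only [orient] at * <;>
        refine ⟨?_, ?_, ?_⟩ <;> nlinarith
    · rw [heq]
      exact (convex_setOf_orient_nonneg a b).inter
        ((convex_setOf_orient_nonneg b c).inter (convex_setOf_orient_nonneg c a))

/-- Nondegeneracy is needed: for collinear `a b c` the left-hand side contains their whole line. -/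
theorem setOf_inTri_eq_convexHull {a b c : ℝ × ℝ} (h : orient a b c ≠ 0) :
    {p | InTri p a b c} = convexHull ℝ {a, b, c} := by
  rcases h.lt_or_gt with h | h
  · have h' : 0 < orient a c b := by rw [orient_swap_right]; linarith
    have := setOf_inTri_eq_convexHull_of_pos h'
    simp only [inTri_swap_iff] at this
    rw [this, Set.pair_comm]
  · exact setOf_inTri_eq_convexHull_of_pos h

/-- Whether the triangle `a b c` is positively oriented. -/
noncomputable def posOriented (a b c : ℝ × ℝ) : Bool := decide (0 < orient a b c)

theorem posOriented_swap_left {a b c : ℝ × ℝ} (h : orient a b c ≠ 0) :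
    posOriented b a c = !posOriented a b c := by
  unfold posOriented
  rw [orient_swap_left]
  rcases h.lt_or_gt with h | h <;> simp [h, h.le]

theorem posOriented_swap_right {a b c : ℝ × ℝ} (h : orient a b c ≠ 0) :
    posOriented a c b = !posOriented a b c := by
  unfold posOriented
  rw [orient_swap_right]
  rcases h.lt_or_gt with h | h <;> simp [h, h.le]

theorem posOriented_rotate (a b c : ℝ × ℝ) : posOriented b c a = posOriented a b c := by
  unfold posOriented
  rw [orient_rotate]

theorem inTri_iff_of_ne {p a b c : ℝ × ℝ} (h1 : orient p a b ≠ 0) (h2 : orient p b c ≠ 0)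
    (h3 : orient p c a ≠ 0) :
    InTri p a b c ↔ posOriented p a b = posOriented p b c ∧
      posOriented p b c = posOriented p c a := by
  unfold InTri posOriented
  rcases h1.lt_or_gt with h1 | h1 <;> rcases h2.lt_or_gt with h2 | h2 <;>
    rcases h3.lt_or_gt with h3 | h3 <;>
    simp [h1, h2, h3, h1.le, h2.le, h3.le, h1.not_gt, h2.not_gt, h3.not_gt, h1.not_ge, h2.not_ge,
      h3.not_ge]

/-- The orientations of four points in general position tell which of them lies in the triangle
of the other three. -/
theorem inTri_four {a b c d : ℝ × ℝ} (h1 : orient b c d ≠ 0) (h2 : orient a c d ≠ 0)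
    (h3 : orient a b d ≠ 0) (h4 : orient a b c ≠ 0) :
    (InTri a b c d ↔ posOriented a b c = posOriented a c d ∧
        posOriented a c d = !posOriented a b d) ∧
    (InTri b a c d ↔ (!posOriented a b c) = posOriented b c d ∧
        posOriented b c d = posOriented a b d) ∧
    (InTri c a b d ↔ posOriented a b c = (!posOriented b c d) ∧
        (!posOriented b c d) = posOriented a c d) ∧
    (InTri d a b c ↔ posOriented a b d = posOriented b c d ∧
        posOriented b c d = !posOriented a c d) := by
  have e4 : orient c a b = orient a b c := by rw [orient_rotate, orient_rotate]
  have e7 : orient d a b = orient a b d := by rw [orient_rotate, orient_rotate]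
  have e8 : orient d b c = orient b c d := by rw [orient_rotate, orient_rotate]
  refine ⟨?_, ?_, ?_, ?_⟩
  · rw [inTri_iff_of_ne h4 h2 (by rw [orient_swap_right]; exact neg_ne_zero.2 h3),
      posOriented_swap_right h3]
  · rw [inTri_iff_of_ne (by rw [orient_swap_left]; exact neg_ne_zero.2 h4) h1
      (by rwa [orient_rotate]), posOriented_swap_left h4, posOriented_rotate a b d]
  · rw [inTri_iff_of_ne (by rwa [e4]) (by rw [orient_swap_left]; exact neg_ne_zero.2 h1)
      (by rwa [orient_rotate]), posOriented_swap_left h1, ← posOriented_rotate c a b,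
      posOriented_rotate a c d]
  · rw [inTri_iff_of_ne (by rwa [e7]) (by rwa [e8])
      (by rw [orient_swap_left, orient_rotate]; exact neg_ne_zero.2 h2),
      ← posOriented_rotate d a b, ← posOriented_rotate d b c,
      posOriented_swap_left (a := c) (b := d) (c := a) (by rwa [orient_rotate]),
      posOriented_rotate a c d]

theorem signs_of_add_eq_zero {x y z : ℝ} (hx : x ≠ 0) (hy : y ≠ 0) (hz : z ≠ 0)
    (h : x - y + z = 0) : ¬ (decide (0 < x) = (!decide (0 < y)) ∧
      decide (0 < x) = decide (0 < z)) := by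
  rintro ⟨i, j⟩
  rcases hx.lt_or_gt with h1 | h1 <;> rcases hy.lt_or_gt with h2 | h2 <;>
    rcases hz.lt_or_gt with h3 | h3 <;>
    simp [h1, h2, h3, h1.not_gt, h2.not_gt, h3.not_gt] at i j <;> linarith

/-- The affine relation between the orientations of four points forbids two sign patterns. -/
theorem posOriented_four {a b c d : ℝ × ℝ} (h1 : orient b c d ≠ 0) (h2 : orient a c d ≠ 0)
    (h3 : orient a b d ≠ 0) (h4 : orient a b c ≠ 0) :
    ¬ (posOriented b c d = (!posOriented a c d) ∧ posOriented b c d = posOriented a b d ∧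
      posOriented b c d = !posOriented a b c) := by
  have h : orient b c d - orient a c d + orient a b d - orient a b c = 0 := by
    unfold orient; ring
  unfold posOriented
  rintro ⟨i, j, k⟩
  rcases h1.lt_or_gt with h1 | h1 <;> rcases h2.lt_or_gt with h2 | h2 <;>
    rcases h3.lt_or_gt with h3 | h3 <;> rcases h4.lt_or_gt with h4 | h4 <;>
    simp [h1, h2, h3, h4, h1.not_gt, h2.not_gt, h3.not_gt, h4.not_gt] at i j k <;> linarith

theorem decide_mul_pos {x y : ℝ} (hx : x ≠ 0) (hy : y ≠ 0) :
    decide (0 < x * y) = (decide (0 < x) == decide (0 < y)) := by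
  rcases hx.lt_or_gt with h1 | h1 <;> rcases hy.lt_or_gt with h2 | h2
  · simp [mul_pos_of_neg_of_neg h1 h2, h1.not_gt, h2.not_gt]
  · simp [(mul_neg_of_neg_of_pos h1 h2).not_gt, h1.not_gt, h2]
  · simp [(mul_neg_of_pos_of_neg h1 h2).not_gt, h1, h2.not_gt]
  · simp [mul_pos h1 h2, h1, h2]

/-- The three-term Grassmann–Plücker relation, read on signs. -/
theorem posOriented_five {p a b c d : ℝ × ℝ} (h1 : orient p a b ≠ 0) (h2 : orient p c d ≠ 0)
    (h3 : orient p a c ≠ 0) (h4 : orient p b d ≠ 0) (h5 : orient p a d ≠ 0)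
    (h6 : orient p b c ≠ 0) :
    ¬ ((posOriented p a b == posOriented p c d) = (!(posOriented p a c == posOriented p b d)) ∧
      (posOriented p a b == posOriented p c d) = (posOriented p a d == posOriented p b c)) := by
  have h : orient p a b * orient p c d - orient p a c * orient p b d
      + orient p a d * orient p b c = 0 := by
    unfold orient; ring
  have := signs_of_add_eq_zero (mul_ne_zero h1 h2) (mul_ne_zero h3 h4) (mul_ne_zero h5 h6) h
  rw [decide_mul_pos h1 h2, decide_mul_pos h3 h4, decide_mul_pos h5 h6] at this
  unfold posOriented
  convert this

/-! ### Points in convex position -/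

theorem GenPos.comp {m n : ℕ} {z : Fin n → ℝ × ℝ} (h : GenPos z) {f : Fin m → Fin n}
    (hf : Function.Injective f) : GenPos (z ∘ f) :=
  fun _ _ _ hij hik hjk => h _ _ _ (hf.ne hij) (hf.ne hik) (hf.ne hjk)

open Classical in
/-- The number of points of a quadruple which lie in the triangle of the other three. -/
noncomputable def innerCount (z : Fin 4 → ℝ × ℝ) : ℝ :=
  ∑ l, if InTri (z l) (z (l.succAbove 0)) (z (l.succAbove 1)) (z (l.succAbove 2)) then 1 else 0

open Classical in
/-- The number of ordered pairs of points of a quintuple which both lie in the triangle of the other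
three. -/
noncomputable def innerPairCount (z : Fin 5 → ℝ × ℝ) : ℝ :=
  ∑ e : Fin 5, ∑ l : Fin 4,
    (if InTri (z (e.succAbove l)) (z (e.succAbove (l.succAbove 0)))
        (z (e.succAbove (l.succAbove 1))) (z (e.succAbove (l.succAbove 2))) then 1 else 0) *
      (if InTri (z e) (z (e.succAbove (l.succAbove 0)))
        (z (e.succAbove (l.succAbove 1))) (z (e.succAbove (l.succAbove 2))) then 1 else 0)

theorem image_compl_singleton_four (z : Fin 4 → ℝ × ℝ) (l : Fin 4) :
    z '' (Set.univ \ {l}) = {z (l.succAbove 0), z (l.succAbove 1), z (l.succAbove 2)} := by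
  have : (Set.univ \ {l} : Set (Fin 4)) = Set.range l.succAbove := by
    rw [Fin.range_succAbove, Set.compl_eq_univ_sdiff]
  rw [this, ← Set.range_comp]
  ext p
  simp only [Set.mem_range, Function.comp, Fin.exists_fin_succ, Set.mem_insert_iff,
    Set.mem_singleton_iff]
  simp [eq_comm]

theorem convexIndependent_four_iff {z : Fin 4 → ℝ × ℝ} (hz : GenPos z) :
    ConvexIndependent ℝ z ↔
      ∀ l, ¬ InTri (z l) (z (l.succAbove 0)) (z (l.succAbove 1)) (z (l.succAbove 2)) := by
  rw [convexIndependent_iff_notMem_convexHull_sdiff]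
  have inj := fun l : Fin 4 => (Fin.succAbove_right_injective (p := l))
  have hl : ∀ l : Fin 4, InTri (z l) (z (l.succAbove 0)) (z (l.succAbove 1)) (z (l.succAbove 2)) ↔
      z l ∈ convexHull ℝ (z '' (Set.univ \ {l})) := by
    intro l
    rw [image_compl_singleton_four, ← setOf_inTri_eq_convexHull]
    · rfl
    · exact hz _ _ _ ((inj l).ne (by decide)) ((inj l).ne (by decide)) ((inj l).ne (by decide))
  constructor
  · intro h l
    rw [hl]
    exact h l _
  · intro h l s hs
    refine h l ((hl l).2 (convexHull_mono ?_ hs))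
    exact Set.image_mono (Set.sdiff_subset_sdiff_left (Set.subset_univ s))

/-- By Carathéodory, five points of the plane are in convex position as soon as each of their
quadruples is. -/
theorem convexIndependent_five_iff (z : Fin 5 → ℝ × ℝ) :
    ConvexIndependent ℝ z ↔ ∀ e : Fin 5, ConvexIndependent ℝ (z ∘ e.succAbove) := by
  constructor
  · intro h e
    exact h.comp_embedding ⟨_, Fin.succAbove_right_injective (p := e)⟩
  · intro h
    rw [convexIndependent_iff_notMem_convexHull_sdiff]
    intro i s hi
    rw [convexHull_eq_union] at hi
    simp only [Set.mem_iUnion] at hi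
    obtain ⟨t, ht, hai, hit⟩ := hi
    -- at most three of the other four points are used, so one of them can be dropped
    have hcard : t.card ≤ 3 := by
      have := hai.card_le_finrank_succ
      rw [Fintype.card_coe] at this
      have h2 : Module.finrank ℝ (vectorSpan ℝ (Set.range ((↑) : t → ℝ × ℝ))) ≤ 2 := by
        refine (Submodule.finrank_le _).trans ?_
        simp
      omega
    have ht' : ∀ x ∈ t, ∃ j, j ∈ s \ {i} ∧ z j = x := fun x hx => ht hx
    choose! g hg hgz using ht'
    have hsub : (t : Set (ℝ × ℝ)) ⊆ z '' (t.image g : Finset (Fin 5)) := by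
      intro x hx
      exact ⟨g x, Finset.mem_coe.2 (Finset.mem_image_of_mem g hx), hgz x hx⟩
    have hi' : i ∉ t.image g := by
      simp only [Finset.mem_image, not_exists, not_and]
      intro x hx hxi
      exact (hg x hx).2 hxi
    obtain ⟨e, he⟩ : ∃ e, e ∉ insert i (t.image g) := by
      by_contra! hcon
      have h1 : Finset.univ ⊆ insert i (t.image g) := fun e _ => hcon e
      have h2 := Finset.card_le_card h1
      have h3 := Finset.card_insert_le i (t.image g)
      have h4 := Finset.card_image_le (s := t) (f := g)
      simp at h2
      omega
    rw [Finset.mem_insert, not_or] at he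
    obtain ⟨a, rfl⟩ := Fin.exists_succAbove_eq (Ne.symm he.1)
    refine hi' (h e (e.succAbove ⁻¹' ↑(t.image g)) a (convexHull_mono ?_ hit))
    intro x hx
    obtain ⟨j, hj, rfl⟩ := hsub hx
    obtain ⟨b, rfl⟩ := Fin.exists_succAbove_eq (y := e) (x := j) (fun h => he.2 (by rwa [← h]))
    exact ⟨b, hj, rfl⟩

open Classical in
/-- Of four points in general position, at most one lies in the triangle of the others. -/
theorem indicator_convexIndependent_four {z : Fin 4 → ℝ × ℝ} (hz : GenPos z) :
    (if ConvexIndependent ℝ z then (1 : ℝ) else 0) = 1 - innerCount z := by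
  rw [convexIndependent_four_iff hz]
  have h1 := hz 1 2 3 (by decide) (by decide) (by decide)
  have h2 := hz 0 2 3 (by decide) (by decide) (by decide)
  have h3 := hz 0 1 3 (by decide) (by decide) (by decide)
  have h4 := hz 0 1 2 (by decide) (by decide) (by decide)
  have H := posOriented_four h1 h2 h3 h4
  obtain ⟨i0, i1, i2, i3⟩ := inTri_four h1 h2 h3 h4
  have s0 : ((0 : Fin 4).succAbove 0, (0 : Fin 4).succAbove 1, (0 : Fin 4).succAbove 2)
    = (1, 2, 3) := by decide
  have s1 : ((1 : Fin 4).succAbove 0, (1 : Fin 4).succAbove 1, (1 : Fin 4).succAbove 2)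
    = (0, 2, 3) := by decide
  have s2 : ((2 : Fin 4).succAbove 0, (2 : Fin 4).succAbove 1, (2 : Fin 4).succAbove 2)
    = (0, 1, 3) := by decide
  have s3 : ((3 : Fin 4).succAbove 0, (3 : Fin 4).succAbove 1, (3 : Fin 4).succAbove 2)
    = (0, 1, 2) := by decide
  simp only [Prod.mk.injEq] at s0 s1 s2 s3
  simp only [innerCount, Fin.forall_fin_succ, Fin.sum_univ_four, Fin.succ_zero_eq_one,
    Fin.succ_one_eq_two, show Fin.succ (2 : Fin 3) = (3 : Fin 4) from rfl, s0, s1, s2, s3, i0, i1,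
    i2, i3]
  generalize posOriented (z 1) (z 2) (z 3) = a at *
  generalize posOriented (z 0) (z 2) (z 3) = b at *
  generalize posOriented (z 0) (z 1) (z 3) = c at *
  generalize posOriented (z 0) (z 1) (z 2) = d at *
  clear i0 i1 i2 i3 h1 h2 h3 h4 hz s0 s1 s2 s3
  cases a <;> cases b <;> cases c <;> cases d <;> simp at *

/-- Five points in general position have a convex hull with five, four or three vertices; then the
sum of their inner counts is `0`, `2` or `4`, and the inner pair count is `0`, `0` or `2`. -/
theorem sum_innerCount_eq {z : Fin 5 → ℝ × ℝ} (hz : GenPos z) :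
    (ConvexIndependent ℝ z →
        ∑ e : Fin 5, innerCount (z ∘ e.succAbove) = innerPairCount z) ∧
      (¬ ConvexIndependent ℝ z →
        ∑ e : Fin 5, innerCount (z ∘ e.succAbove) = 2 + innerPairCount z) := by
  have hq : ∀ e : Fin 5, GenPos (z ∘ e.succAbove) :=
    fun e => hz.comp (Fin.succAbove_right_injective (p := e))
  have hC := convexIndependent_five_iff z
  simp_rw [convexIndependent_four_iff (hq _)] at hC
  have ha := hz 0 1 2 (by decide) (by decide) (by decide)
  have hb := hz 0 1 3 (by decide) (by decide) (by decide)
  have hc := hz 0 1 4 (by decide) (by decide) (by decide)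
  have hd := hz 0 2 3 (by decide) (by decide) (by decide)
  have he := hz 0 2 4 (by decide) (by decide) (by decide)
  have hf := hz 0 3 4 (by decide) (by decide) (by decide)
  have hg := hz 1 2 3 (by decide) (by decide) (by decide)
  have hh := hz 1 2 4 (by decide) (by decide) (by decide)
  have hi := hz 1 3 4 (by decide) (by decide) (by decide)
  have hj := hz 2 3 4 (by decide) (by decide) (by decide)
  have A0 := posOriented_four hj hi hh hg
  have A1 := posOriented_four hj hf he hd
  have A2 := posOriented_four hi hf hc hb
  have A3 := posOriented_four hh he hc ha
  have A4 := posOriented_four hg hd hb ha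
  have P0 := posOriented_five ha hf hb he hc hd
  have hz' : ∀ i j k : Fin 5, i ≠ j ∧ i ≠ k ∧ j ≠ k → orient (z i) (z j) (z k) ≠ 0 :=
    fun i j k h => hz i j k h.1 h.2.1 h.2.2
  have P1 := posOriented_five (hz' 1 0 2 (by decide)) (hz' 1 3 4 (by decide))
    (hz' 1 0 3 (by decide)) (hz' 1 2 4 (by decide)) (hz' 1 0 4 (by decide)) (hz' 1 2 3 (by decide))
  have P2 := posOriented_five (hz' 2 0 1 (by decide)) (hz' 2 3 4 (by decide))
    (hz' 2 0 3 (by decide)) (hz' 2 1 4 (by decide)) (hz' 2 0 4 (by decide)) (hz' 2 1 3 (by decide))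
  have P3 := posOriented_five (hz' 3 0 1 (by decide)) (hz' 3 2 4 (by decide))
    (hz' 3 0 2 (by decide)) (hz' 3 1 4 (by decide)) (hz' 3 0 4 (by decide)) (hz' 3 1 2 (by decide))
  have P4 := posOriented_five (hz' 4 0 1 (by decide)) (hz' 4 2 3 (by decide))
    (hz' 4 0 2 (by decide)) (hz' 4 1 3 (by decide)) (hz' 4 0 3 (by decide)) (hz' 4 1 2 (by decide))
  rw [posOriented_swap_left ha, posOriented_swap_left hb, posOriented_swap_left hc] at P1
  rw [← posOriented_rotate (z 2) (z 0) (z 1), posOriented_swap_left hd, posOriented_swap_left he,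
    posOriented_swap_left hg, posOriented_swap_left hh] at P2
  rw [← posOriented_rotate (z 3) (z 0) (z 1), ← posOriented_rotate (z 3) (z 0) (z 2),
    ← posOriented_rotate (z 3) (z 1) (z 2), posOriented_swap_left hf, posOriented_swap_left hi,
    posOriented_swap_left hj] at P3
  rw [← posOriented_rotate (z 4) (z 0) (z 1), ← posOriented_rotate (z 4) (z 0) (z 2),
    ← posOriented_rotate (z 4) (z 0) (z 3), ← posOriented_rotate (z 4) (z 1) (z 2),
    ← posOriented_rotate (z 4) (z 1) (z 3), ← posOriented_rotate (z 4) (z 2) (z 3)] at P4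
  obtain ⟨i01, i02, i03, i04⟩ := inTri_four hj hi hh hg
  obtain ⟨i11, i12, i13, i14⟩ := inTri_four hj hf he hd
  obtain ⟨i21, i22, i23, i24⟩ := inTri_four hi hf hc hb
  obtain ⟨i31, i32, i33, i34⟩ := inTri_four hh he hc ha
  obtain ⟨i41, i42, i43, i44⟩ := inTri_four hg hd hb ha
  simp [Fin.succAbove, Fin.forall_fin_succ] at hC
  simp only [i01, i02, i03, i04, i11, i12, i13, i14, i21, i22, i23, i24, i31, i32, i33, i34, i41,
    i42, i43, i44] at hC
  simp [innerPairCount, innerCount, Fin.sum_univ_succ, Fin.succAbove, -Finset.sum_boole]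
  simp only [hC, i01, i02, i03, i04, i11, i12, i13, i14, i21, i22, i23, i24, i31, i32, i33, i34,
    i41, i42, i43, i44]
  clear hC
  clear i01 i02 i03 i04 i11 i12 i13 i14 i21 i22 i23 i24 i31 i32 i33 i34 i41 i42 i43 i44
  clear ha hb hc hd he hf hg hh hi hj hz hz' hq
  -- the ten orientations become Boolean variables
  generalize posOriented (z 0) (z 1) (z 2) = a at *
  generalize posOriented (z 0) (z 1) (z 3) = b at *
  generalize posOriented (z 0) (z 1) (z 4) = c at *
  generalize posOriented (z 0) (z 2) (z 3) = d at *
  generalize posOriented (z 0) (z 2) (z 4) = e at *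
  generalize posOriented (z 0) (z 3) (z 4) = f at *
  generalize posOriented (z 1) (z 2) (z 3) = g at *
  generalize posOriented (z 1) (z 2) (z 4) = h at *
  generalize posOriented (z 1) (z 3) (z 4) = i at *
  generalize posOriented (z 2) (z 3) (z 4) = j at *
  clear z
  norm_cast
  -- Only sign patterns obeying the five affine and the five Grassmann–Plücker relations occur;
  -- the identity holds for each of them and fails for some of the others.
  have K := And.intro (And.intro A0 (And.intro A1 (And.intro A2 (And.intro A3 A4))))
    (And.intro P0 (And.intro P1 (And.intro P2 (And.intro P3 P4))))
  clear A0 A1 A2 A3 A4 P0 P1 P2 P3 P4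
  revert a b c d e f g h i j
  set_option synthInstance.maxSize 100000 in
  set_option synthInstance.maxHeartbeats 4000000 in
  set_option maxRecDepth 100000 in
  decide +kernel

open Classical in
theorem two_mul_indicator_convexIndependent_five {z : Fin 5 → ℝ × ℝ} (hz : GenPos z) :
    2 * (if ConvexIndependent ℝ z then (1 : ℝ) else 0) =
      2 - ∑ e : Fin 5, innerCount (z ∘ e.succAbove) + innerPairCount z := by
  split_ifs with h
  · rw [(sum_innerCount_eq hz).1 h]; ring
  · rw [(sum_innerCount_eq hz).2 h]; ring

/-! ### Areas of triangles and general position -/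

theorem continuous_orient : Continuous fun t : (ℝ × ℝ) × (ℝ × ℝ) × (ℝ × ℝ) =>
    orient t.1 t.2.1 t.2.2 := by
  unfold orient; fun_prop

theorem Measurable.orient {α : Type*} [MeasurableSpace α] {f g h : α → ℝ × ℝ} (hf : Measurable f)
    (hg : Measurable g) (hh : Measurable h) : Measurable fun x => orient (f x) (g x) (h x) :=
  continuous_orient.measurable.comp (hf.prodMk (hg.prodMk hh))

theorem measurableSet_inTri {α : Type*} [MeasurableSpace α] {f g h k : α → ℝ × ℝ}
    (hf : Measurable f) (hg : Measurable g) (hh : Measurable h) (hk : Measurable k) :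
    MeasurableSet {x | InTri (f x) (g x) (h x) (k x)} := by
  unfold InTri
  have h1 := hf.orient hg hh
  have h2 := hf.orient hh hk
  have h3 := hf.orient hk hg
  exact ((measurableSet_le measurable_const h1).inter ((measurableSet_le measurable_const h2).inter
    (measurableSet_le measurable_const h3))).union ((measurableSet_le h1 measurable_const).inter
    ((measurableSet_le h2 measurable_const).inter (measurableSet_le h3 measurable_const)))

theorem volume_standard_triangle :
    volume {q : ℝ × ℝ | 0 ≤ q.1 ∧ 0 ≤ q.2 ∧ q.1 + q.2 ≤ 1} = ENNReal.ofReal (1 / 2) := by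
  have hm : MeasurableSet {q : ℝ × ℝ | 0 ≤ q.1 ∧ 0 ≤ q.2 ∧ q.1 + q.2 ≤ 1} := by
    apply IsClosed.measurableSet
    refine (isClosed_le continuous_const continuous_fst).inter
      ((isClosed_le continuous_const continuous_snd).inter
      (isClosed_le (continuous_fst.add continuous_snd) continuous_const))
  rw [Measure.volume_eq_prod, Measure.prod_apply hm]
  have : ∀ x : ℝ, volume (Prod.mk x ⁻¹' {q : ℝ × ℝ | 0 ≤ q.1 ∧ 0 ≤ q.2 ∧ q.1 + q.2 ≤ 1}) =
      (Set.Icc (0 : ℝ) 1).indicator (fun x => ENNReal.ofReal (1 - x)) x := by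
    intro x
    by_cases hx : x ∈ Set.Icc (0 : ℝ) 1
    · rw [Set.indicator_of_mem hx]
      have : Prod.mk x ⁻¹' {q : ℝ × ℝ | 0 ≤ q.1 ∧ 0 ≤ q.2 ∧ q.1 + q.2 ≤ 1} = Set.Icc 0 (1 - x) := by
        ext y
        simp only [Set.mem_preimage, Set.mem_ofPred_eq, Set.mem_Icc]
        constructor
        · rintro ⟨_, h2, h3⟩; exact ⟨h2, by linarith⟩
        · rintro ⟨h2, h3⟩; exact ⟨hx.1, h2, by linarith⟩
      rw [this, Real.volume_Icc, sub_zero]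
    · rw [Set.indicator_of_notMem hx]
      convert measure_empty (μ := (volume : Measure ℝ))
      ext y
      simp only [Set.mem_preimage, Set.mem_ofPred_eq, Set.mem_empty_iff_false, iff_false]
      rintro ⟨h1, h2, h3⟩
      exact hx ⟨h1, by linarith⟩
  simp_rw [this]
  rw [lintegral_indicator measurableSet_Icc, ← ofReal_integral_eq_lintegral_ofReal]
  · rw [integral_Icc_eq_integral_Ioc, ← intervalIntegral.integral_of_le zero_le_one]
    congr 1
    rw [intervalIntegral.integral_sub (by simp) (by simp)]
    simp; norm_num
  · exact (continuous_const.sub continuous_id).continuousOn.integrableOn_Icc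
  · refine (ae_restrict_iff' measurableSet_Icc).2 (Filter.Eventually.of_forall fun x hx => ?_)
    simpa using hx.2

/-- The area of a triangle is half the absolute value of its determinant. -/
theorem volume_inTri {a b c : ℝ × ℝ} (h : orient a b c ≠ 0) :
    volume {p | InTri p a b c} = ENNReal.ofReal (|orient a b c| / 2) := by
  let M : Matrix (Fin 2) (Fin 2) ℝ := !![b.1 - a.1, c.1 - a.1; b.2 - a.2, c.2 - a.2]
  let T : ℝ × ℝ →ₗ[ℝ] ℝ × ℝ := Matrix.toLin (Module.Basis.finTwoProd ℝ) (Module.Basis.finTwoProd ℝ) M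
  have hT : ∀ q : ℝ × ℝ, T q = q.1 • (b - a) + q.2 • (c - a) := by
    intro q
    simp only [T, M, Matrix.toLin_finTwoProd_apply]
    ext <;> simp <;> ring
  have hdet : LinearMap.det T = orient a b c := by
    simp only [T, LinearMap.det_toLin, M, Matrix.det_fin_two_of]
    unfold orient; ring
  have himg : {p | InTri p a b c} =
      (fun p => a + p) '' (T '' {q : ℝ × ℝ | 0 ≤ q.1 ∧ 0 ≤ q.2 ∧ q.1 + q.2 ≤ 1}) := by
    rw [setOf_inTri_eq_convexHull h]
    have hstd : {q : ℝ × ℝ | 0 ≤ q.1 ∧ 0 ≤ q.2 ∧ q.1 + q.2 ≤ 1} =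
        convexHull ℝ {((0 : ℝ), (0 : ℝ)), (1, 0), (0, 1)} := by
      rw [← setOf_inTri_eq_convexHull_of_pos (by simp [orient])]
      ext q
      rw [Set.mem_ofPred_eq, Set.mem_ofPred_eq, inTri_iff_of_pos (by simp [orient])]
      simp only [orient]
      constructor
      · rintro ⟨h1, h2, h3⟩; refine ⟨?_, ?_, ?_⟩ <;> linarith
      · rintro ⟨h1, h2, h3⟩; refine ⟨?_, ?_, ?_⟩ <;> linarith
    have himage := convexHull_vadd (𝕜 := ℝ) a (T '' {((0 : ℝ), (0 : ℝ)), (1, 0), (0, 1)})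
    rw [hstd, LinearMap.image_convexHull]
    refine Eq.trans ?_ himage
    congr 1
    simp only [← Set.image_vadd, Set.image_insert_eq, Set.image_singleton, hT]
    simp
  rw [himg, Set.image_add_left, measure_preimage_add, Measure.addHaar_image_linearMap, hdet,
    volume_standard_triangle, ← ENNReal.ofReal_mul (abs_nonneg _)]
  congr 1; ring

/-- Distinct abscissas make the line through `a` and `b` meet every vertical line in one point. -/
theorem volume_setOf_orient_eq_zero {a b : ℝ × ℝ} (h : a.1 ≠ b.1) :
    volume {p : ℝ × ℝ | orient p a b = 0} = 0 := by
  have hm : MeasurableSet {p : ℝ × ℝ | orient p a b = 0} :=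
    measurableSet_eq_fun (measurable_id.orient measurable_const measurable_const) measurable_const
  rw [Measure.volume_eq_prod, Measure.measure_prod_null hm]
  refine Filter.Eventually.of_forall fun x => ?_
  refine (Set.Subsingleton.measure_zero ?_ volume)
  intro y hy y' hy'
  simp only [Set.mem_preimage, Set.mem_ofPred_eq, orient] at hy hy'
  have : (y - y') * (b.1 - a.1) = 0 := by linarith
  rcases mul_eq_zero.1 this with h1 | h1
  · linarith
  · exact absurd (by linarith) h

theorem volume_setOf_fst_eq (x : ℝ) : volume {p : ℝ × ℝ | p.1 = x} = 0 := by
  have hm : MeasurableSet {p : ℝ × ℝ | p.1 = x} :=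
    measurableSet_eq_fun measurable_fst measurable_const
  have : {p : ℝ × ℝ | p.1 = x} = {x} ×ˢ Set.univ := by ext; simp
  rw [this, Measure.volume_eq_prod, Measure.prod_prod]
  simp

section Tuples

variable {μ : Measure (ℝ × ℝ)} [IsProbabilityMeasure μ] {n : ℕ}

theorem measurePreserving_succAbove (e : Fin (n + 1)) :
    MeasurePreserving (fun z : Fin (n + 1) → ℝ × ℝ => (z e, z ∘ e.succAbove))
      (Measure.pi fun _ => μ) (μ.prod (Measure.pi fun _ => μ)) :=
  measurePreserving_piFinSuccAbove (fun _ => μ) e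

/-- A property of one point of a random tuple relative to the others may be checked with the others
fixed. -/
theorem ae_pi_of_ae_ae (e : Fin (n + 1)) {s : Set ((ℝ × ℝ) × (Fin n → ℝ × ℝ))}
    (hs : MeasurableSet s)
    (h : ∀ᵐ t ∂(Measure.pi fun _ : Fin n => μ), ∀ᵐ p ∂μ, (p, t) ∈ s) :
    ∀ᵐ z ∂(Measure.pi fun _ : Fin (n + 1) => μ), (z e, z ∘ e.succAbove) ∈ s := by
  refine (measurePreserving_succAbove (μ := μ) e).quasiMeasurePreserving.ae (p := fun w => w ∈ s) ?_
  have := (Measure.ae_prod_iff_ae_ae (μ := Measure.pi fun _ : Fin n => μ) (ν := μ)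
    (p := fun w => w.swap ∈ s) (measurable_swap hs)).2 h
  have h2 := (Measure.measurePreserving_swap (μ := μ)
    (ν := Measure.pi fun _ : Fin n => μ)).quasiMeasurePreserving.ae this
  simpa using h2

theorem ae_fst_ne (hμ : μ ≪ volume) {i j : Fin n} (hij : i ≠ j) :
    ∀ᵐ z ∂(Measure.pi fun _ : Fin n => μ), (z i).1 ≠ (z j).1 := by
  obtain _ | n := n
  · exact i.elim0
  obtain ⟨k, rfl⟩ := Fin.exists_succAbove_eq hij.symm
  have hs : MeasurableSet {w : (ℝ × ℝ) × (Fin n → ℝ × ℝ) | w.1.1 ≠ (w.2 k).1} :=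
    (measurableSet_eq_fun (by fun_prop) (by fun_prop)).compl
  refine ae_pi_of_ae_ae i hs (Filter.Eventually.of_forall fun t => ?_)
  exact measure_mono_null (fun p hp => by simpa using hp) (hμ (volume_setOf_fst_eq (t k).1))

theorem ae_orient_ne_zero (hμ : μ ≪ volume) {i j k : Fin n} (hij : i ≠ j) (hik : i ≠ k)
    (hjk : j ≠ k) :
    ∀ᵐ z ∂(Measure.pi fun _ : Fin n => μ), orient (z i) (z j) (z k) ≠ 0 := by
  obtain _ | n := n
  · exact i.elim0
  obtain ⟨j, rfl⟩ := Fin.exists_succAbove_eq hij.symm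
  obtain ⟨k, rfl⟩ := Fin.exists_succAbove_eq hik.symm
  have hs : MeasurableSet {w : (ℝ × ℝ) × (Fin n → ℝ × ℝ) | orient w.1 (w.2 j) (w.2 k) ≠ 0} :=
    (measurableSet_eq_fun (Measurable.orient (by fun_prop) (by fun_prop) (by fun_prop))
      measurable_const).compl
  refine ae_pi_of_ae_ae i hs ?_
  filter_upwards [ae_fst_ne hμ (fun h => hjk (by rw [h]) : j ≠ k)] with t ht
  exact measure_mono_null (fun p hp => by simpa using hp) (hμ (volume_setOf_orient_eq_zero ht))

theorem ae_genPos (hμ : μ ≪ volume) :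
    ∀ᵐ z ∂(Measure.pi fun _ : Fin n => μ), GenPos z := by
  simp only [GenPos, ae_all_iff]
  exact fun i j k hij hik hjk => ae_orient_ne_zero hμ hij hik hjk

theorem integral_comp_succAbove (e : Fin (n + 1)) (g : (Fin n → ℝ × ℝ) → ℝ) :
    ∫ z, g (z ∘ e.succAbove) ∂(Measure.pi fun _ : Fin (n + 1) => μ) =
      ∫ t, g t ∂(Measure.pi fun _ : Fin n => μ) := by
  have h := (measurePreserving_piFinSuccAbove (fun _ : Fin (n + 1) => μ) e).integral_comp'
    (fun w => g w.2)
  refine h.trans ?_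
  rw [integral_fun_snd]
  simp

open Classical in
/-- Integrating out one point of a random tuple, when the others enter through a bounded
factor. -/
theorem integral_ite_mul (e : Fin (n + 1)) {s : Set ((ℝ × ℝ) × (Fin n → ℝ × ℝ))}
    (hs : MeasurableSet s) {g : (Fin n → ℝ × ℝ) → ℝ} (hg : Measurable g)
    (hg1 : ∀ t, ‖g t‖ ≤ 1) :
    ∫ z, (if (z e, z ∘ e.succAbove) ∈ s then 1 else 0) * g (z ∘ e.succAbove)
        ∂(Measure.pi fun _ : Fin (n + 1) => μ) =
      ∫ t, μ.real {p | (p, t) ∈ s} * g t ∂(Measure.pi fun _ : Fin n => μ) := by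
  have h := (measurePreserving_piFinSuccAbove (fun _ : Fin (n + 1) => μ) e).integral_comp'
    (fun w => (if w ∈ s then 1 else 0) * g w.2)
  refine h.trans ?_
  have hmeas : Measurable fun w : (ℝ × ℝ) × (Fin n → ℝ × ℝ) =>
      (if w ∈ s then (1 : ℝ) else 0) * g w.2 :=
    (Measurable.ite hs measurable_const measurable_const).mul (hg.comp measurable_snd)
  rw [integral_prod_symm]
  · refine integral_congr_ae (Filter.Eventually.of_forall fun t => ?_)
    simp only
    rw [integral_mul_const]
    congr 1
    have hst : MeasurableSet {p | (p, t) ∈ s} := measurable_prodMk_right hs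
    rw [← integral_indicator_one hst]
    congr 1
  · refine Integrable.of_bound hmeas.aestronglyMeasurable 1 (Filter.Eventually.of_forall fun w => ?_)
    rw [norm_mul]
    refine mul_le_one₀ ?_ (norm_nonneg _) (hg1 _)
    split_ifs <;> simp

end Tuples

/-! ### Probabilities of convex position from triangle areas -/

section Probability

variable {K : Set (ℝ × ℝ)}

theorem isProbabilityMeasure_cond_volume (h0 : volume K ≠ 0) (htop : volume K ≠ ⊤) :
    IsProbabilityMeasure (cond volume K) :=
  cond_isProbabilityMeasure_of_finite h0 htop

theorem cond_real_inTri (hK : MeasurableSet K) (hc : Convex ℝ K) {a b c : ℝ × ℝ} (ha : a ∈ K)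
    (hb : b ∈ K) (hcK : c ∈ K) (h : orient a b c ≠ 0) :
    (cond volume K).real {p | InTri p a b c} = |orient a b c| / (2 * volume.real K) := by
  have hsub : {p | InTri p a b c} ⊆ K := by
    rw [setOf_inTri_eq_convexHull h]
    exact convexHull_min (by rintro p (rfl | rfl | rfl) <;> assumption) hc
  rw [Measure.real, cond_apply hK, Set.inter_eq_right.2 hsub, volume_inTri h, ENNReal.toReal_mul,
    ENNReal.toReal_inv, ENNReal.toReal_ofReal (by positivity), Measure.real]
  field_simp

theorem ae_mem_of_cond (hK : MeasurableSet K) (n : ℕ) :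
    ∀ᵐ z ∂(Measure.pi fun _ : Fin n => cond volume K), ∀ i, z i ∈ K := by
  rw [ae_all_iff]
  exact fun i => (Measure.quasiMeasurePreserving_eval _ i).ae (ae_cond_mem hK)

theorem cond_volume_absolutelyContinuous : cond volume K ≪ (volume : Measure (ℝ × ℝ)) :=
  cond_absolutelyContinuous

theorem ae_cond_real_inTri (hK : MeasurableSet K) (hc : Convex ℝ K) (h0 : volume K ≠ 0)
    (htop : volume K ≠ ⊤) :
    (fun t : Fin 3 → ℝ × ℝ => (cond volume K).real {p | InTri p (t 0) (t 1) (t 2)})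
      =ᵐ[uniformLaw K 3]
      fun t => |orient (t 0) (t 1) (t 2)| / (2 * volume.real K) := by
  have := isProbabilityMeasure_cond_volume h0 htop
  have hg := ae_genPos (n := 3) (cond_volume_absolutelyContinuous (K := K))
  filter_upwards [hg, ae_mem_of_cond hK 3] with t ht hmem
  exact cond_real_inTri hK hc (hmem 0) (hmem 1) (hmem 2)
    (ht 0 1 2 (by decide) (by decide) (by decide))

/-- Each of the four points is equally likely to lie in the triangle of the others, and given that
triangle the probability is its relative area. -/
theorem integral_innerCount (hK : MeasurableSet K) (hc : Convex ℝ K) (h0 : volume K ≠ 0)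
    (htop : volume K ≠ ⊤) :
    ∫ z, innerCount z ∂(uniformLaw K 4) =
      4 * ∫ t, |orient (t 0) (t 1) (t 2)| / (2 * volume.real K) ∂(uniformLaw K 3) := by
  have := isProbabilityMeasure_cond_volume h0 htop
  classical
  unfold innerCount uniformLaw
  rw [integral_finsetSum]
  · have : ∀ l : Fin 4, ∫ z, (if InTri (z l) (z (l.succAbove 0)) (z (l.succAbove 1))
        (z (l.succAbove 2)) then (1 : ℝ) else 0) ∂(Measure.pi fun _ : Fin 4 => cond volume K) =
        ∫ t, |orient (t 0) (t 1) (t 2)| / (2 * volume.real K)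
          ∂(Measure.pi fun _ : Fin 3 => cond volume K) := by
      intro l
      have hs : MeasurableSet {w : (ℝ × ℝ) × (Fin 3 → ℝ × ℝ) | InTri w.1 (w.2 0) (w.2 1) (w.2 2)} :=
        measurableSet_inTri (by fun_prop) (by fun_prop) (by fun_prop) (by fun_prop)
      have h := integral_ite_mul (μ := cond volume K) l hs (g := fun _ => 1) measurable_const
        (by simp)
      simp only [mul_one] at h
      exact h.trans (integral_congr_ae (ae_cond_real_inTri hK hc h0 htop))
    simp [this]
  · intro l _
    refine Integrable.of_bound (Measurable.aestronglyMeasurable ?_) 1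
      (Filter.Eventually.of_forall fun z => by split_ifs <;> simp)
    exact Measurable.ite (measurableSet_inTri (by fun_prop) (by fun_prop) (by fun_prop)
      (by fun_prop)) measurable_const measurable_const

/-- Given a triangle, two further points lie in it independently, each with probability its relative
area. -/
theorem integral_innerPairCount (hK : MeasurableSet K) (hc : Convex ℝ K) (h0 : volume K ≠ 0)
    (htop : volume K ≠ ⊤) :
    ∫ z, innerPairCount z ∂(uniformLaw K 5) =
      20 * ∫ t, (|orient (t 0) (t 1) (t 2)| / (2 * volume.real K)) ^ 2 ∂(uniformLaw K 3) := by
  have := isProbabilityMeasure_cond_volume h0 htop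
  classical
  set μ := cond volume K with hμ
  have hs : MeasurableSet {w : (ℝ × ℝ) × (Fin 3 → ℝ × ℝ) | InTri w.1 (w.2 0) (w.2 1) (w.2 2)} :=
    measurableSet_inTri (by fun_prop) (by fun_prop) (by fun_prop) (by fun_prop)
  have hm : Measurable fun t : Fin 3 → ℝ × ℝ => μ.real {p | InTri p (t 0) (t 1) (t 2)} :=
    (measurable_measure_prodMk_right hs).ennreal_toReal
  have hi : ∀ l : Fin 4, Measurable fun y : Fin 4 → ℝ × ℝ => if InTri (y l) (y (l.succAbove 0))
      (y (l.succAbove 1)) (y (l.succAbove 2)) then (1 : ℝ) else 0 := fun l =>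
    Measurable.ite (measurableSet_inTri (by fun_prop) (by fun_prop) (by fun_prop)
      (by fun_prop)) measurable_const measurable_const
  have key : ∀ (e : Fin 5) (l : Fin 4), ∫ z,
      (if InTri (z (e.succAbove l)) (z (e.succAbove (l.succAbove 0)))
        (z (e.succAbove (l.succAbove 1))) (z (e.succAbove (l.succAbove 2))) then (1 : ℝ) else 0) *
      (if InTri (z e) (z (e.succAbove (l.succAbove 0)))
        (z (e.succAbove (l.succAbove 1))) (z (e.succAbove (l.succAbove 2))) then 1 else 0)
        ∂(Measure.pi fun _ : Fin 5 => μ) =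
      ∫ t, (|orient (t 0) (t 1) (t 2)| / (2 * volume.real K)) ^ 2
        ∂(Measure.pi fun _ : Fin 3 => μ) := by
    intro e l
    have hs4 : MeasurableSet {w : (ℝ × ℝ) × (Fin 4 → ℝ × ℝ) |
        InTri w.1 (w.2 (l.succAbove 0)) (w.2 (l.succAbove 1)) (w.2 (l.succAbove 2))} :=
      measurableSet_inTri (by fun_prop) (by fun_prop) (by fun_prop) (by fun_prop)
    have h1 := integral_ite_mul (μ := μ) e hs4 (hi l) (fun t => by split_ifs <;> simp)
    have h2 := integral_ite_mul (μ := μ) l hs hm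
      (fun t => by rw [Real.norm_of_nonneg measureReal_nonneg]; exact measureReal_le_one)
    calc _ = _ := integral_congr_ae (Filter.Eventually.of_forall fun z => mul_comm _ _)
      _ = _ := h1
      _ = _ := integral_congr_ae (Filter.Eventually.of_forall fun z => mul_comm _ _)
      _ = _ := h2
      _ = _ := by
        refine integral_congr_ae ?_
        filter_upwards [ae_cond_real_inTri hK hc h0 htop] with t ht
        rw [sq, ← ht]
  unfold innerPairCount uniformLaw
  have hint : ∀ (e : Fin 5) (l : Fin 4), Integrable (fun z : Fin 5 → ℝ × ℝ =>
      (if InTri (z (e.succAbove l)) (z (e.succAbove (l.succAbove 0)))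
        (z (e.succAbove (l.succAbove 1))) (z (e.succAbove (l.succAbove 2))) then (1 : ℝ) else 0) *
      (if InTri (z e) (z (e.succAbove (l.succAbove 0)))
        (z (e.succAbove (l.succAbove 1))) (z (e.succAbove (l.succAbove 2))) then 1 else 0))
      (Measure.pi fun _ : Fin 5 => μ) := by
    intro e l
    refine Integrable.of_bound (Measurable.aestronglyMeasurable ?_) 1
      (Filter.Eventually.of_forall fun z => by split_ifs <;> simp)
    exact (Measurable.ite (measurableSet_inTri (by fun_prop) (by fun_prop) (by fun_prop)
      (by fun_prop)) measurable_const measurable_const).mul (Measurable.ite (measurableSet_inTri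
      (by fun_prop) (by fun_prop) (by fun_prop) (by fun_prop)) measurable_const measurable_const)
  rw [integral_finsetSum _ fun e _ => integrable_finsetSum _ fun l _ => hint e l]
  simp_rw [integral_finsetSum _ fun l _ => hint _ l, key]
  simp
  ring

theorem measurable_innerCount : Measurable innerCount := by
  classical
  unfold innerCount
  refine Finset.measurable_sum _ fun l _ => ?_
  exact Measurable.ite (measurableSet_inTri (by fun_prop) (by fun_prop) (by fun_prop)
      (by fun_prop)) measurable_const measurable_const

theorem measurable_innerPairCount : Measurable innerPairCount := by
  classical
  unfold innerPairCount
  refine Finset.measurable_sum _ fun e _ => Finset.measurable_sum _ fun l _ => ?_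
  exact (Measurable.ite (measurableSet_inTri (by fun_prop) (by fun_prop) (by fun_prop)
    (by fun_prop)) measurable_const measurable_const).mul (Measurable.ite (measurableSet_inTri
    (by fun_prop) (by fun_prop) (by fun_prop) (by fun_prop)) measurable_const measurable_const)

open Classical in
/-- The measure of a set is the integral of any measurable function which agrees almost everywhere
with its indicator; the set itself need not be measurable. -/
theorem measureReal_eq_integral_of_ae {α : Type*} [MeasurableSpace α] {ν : Measure α} {s : Set α}
    {f : α → ℝ} (hf : Measurable f) (h : ∀ᵐ z ∂ν, (if z ∈ s then 1 else 0) = f z) :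
    ν.real s = ∫ z, f z ∂ν := by
  have hs : MeasurableSet {z | f z = 1} := measurableSet_eq_fun hf measurable_const
  have hss : s =ᵐ[ν] {z | f z = 1} := by
    filter_upwards [h] with z hz
    apply propext
    change z ∈ s ↔ f z = 1
    rw [← hz]
    by_cases hzs : z ∈ s <;> simp [hzs]
  rw [measureReal_congr hss, ← integral_indicator_one hs]
  refine integral_congr_ae ?_
  filter_upwards [h] with z hz
  by_cases hzs : z ∈ s
  · rw [if_pos hzs] at hz
    rw [Set.indicator_of_mem (show z ∈ {z | f z = 1} from hz.symm), ← hz, Pi.one_apply]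
  · rw [if_neg hzs] at hz
    have hz' : z ∉ {z | f z = 1} := fun h' : f z = 1 => by
      rw [h'] at hz; exact zero_ne_one hz
    rw [Set.indicator_of_notMem hz', ← hz]

theorem norm_innerCount_le (z : Fin 4 → ℝ × ℝ) : ‖innerCount z‖ ≤ 4 := by
  classical
  unfold innerCount
  refine (norm_sum_le _ _).trans ?_
  refine (Finset.sum_le_sum (fun l _ => (?_ : _ ≤ (1 : ℝ)))).trans (by simp)
  split_ifs <;> simp

theorem norm_innerPairCount_le (z : Fin 5 → ℝ × ℝ) : ‖innerPairCount z‖ ≤ 20 := by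
  classical
  unfold innerPairCount
  refine (norm_sum_le _ _).trans ?_
  refine (Finset.sum_le_sum (fun e _ => (norm_sum_le _ _).trans (Finset.sum_le_sum
    (fun l _ => (?_ : _ ≤ (1 : ℝ)))))).trans (by norm_num)
  split_ifs <;> simp

/-- **Efron's identity** for four points. -/
theorem Q_four (hK : MeasurableSet K) (hc : Convex ℝ K) (h0 : volume K ≠ 0)
    (htop : volume K ≠ ⊤) :
    Q 4 K = 1 - 4 * ∫ t, |orient (t 0) (t 1) (t 2)| / (2 * volume.real K) ∂(uniformLaw K 3) := by
  have := isProbabilityMeasure_cond_volume h0 htop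
  have hp : IsProbabilityMeasure (uniformLaw K 4) := by unfold uniformLaw; infer_instance
  rw [← integral_innerCount hK hc h0 htop]
  have hint : Integrable innerCount (uniformLaw K 4) :=
    Integrable.of_bound measurable_innerCount.aestronglyMeasurable 4
      (Filter.Eventually.of_forall norm_innerCount_le)
  have h := measureReal_eq_integral_of_ae (ν := uniformLaw K 4) (s := convexPosition 4)
    (f := fun z => 1 - innerCount z) (measurable_const.sub measurable_innerCount) (by
      filter_upwards [ae_genPos (n := 4) (cond_volume_absolutelyContinuous (K := K))] with z hz
      exact indicator_convexIndependent_four hz)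
  rw [Q, h, integral_sub (integrable_const _) hint]
  simp

/-- The probability that five points are in convex position depends on the first two moments
of the area of a random triangle. -/
theorem Q_five (hK : MeasurableSet K) (hc : Convex ℝ K) (h0 : volume K ≠ 0)
    (htop : volume K ≠ ⊤) :
    Q 5 K = 1 - 10 * ∫ t, |orient (t 0) (t 1) (t 2)| / (2 * volume.real K) ∂(uniformLaw K 3)
      + 10 * ∫ t, (|orient (t 0) (t 1) (t 2)| / (2 * volume.real K)) ^ 2 ∂(uniformLaw K 3) := by
  have := isProbabilityMeasure_cond_volume h0 htop
  have hp : IsProbabilityMeasure (uniformLaw K 5) := by unfold uniformLaw; infer_instance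
  have hmeas : ∀ e : Fin 5, Measurable fun z : Fin 5 → ℝ × ℝ => innerCount (z ∘ e.succAbove) :=
    fun e => measurable_innerCount.comp (measurable_pi_lambda _ fun i => measurable_pi_apply _)
  have hint : ∀ e : Fin 5, Integrable (fun z : Fin 5 → ℝ × ℝ => innerCount (z ∘ e.succAbove))
      (uniformLaw K 5) := fun e =>
    Integrable.of_bound (hmeas e).aestronglyMeasurable 4
      (Filter.Eventually.of_forall fun z => norm_innerCount_le _)
  have hint2 : Integrable innerPairCount (uniformLaw K 5) :=
    Integrable.of_bound measurable_innerPairCount.aestronglyMeasurable 20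
      (Filter.Eventually.of_forall norm_innerPairCount_le)
  have hsum : Integrable (fun z : Fin 5 → ℝ × ℝ => ∑ e : Fin 5, innerCount (z ∘ e.succAbove))
      (uniformLaw K 5) := integrable_finsetSum _ fun e _ => hint e
  have h := measureReal_eq_integral_of_ae (ν := uniformLaw K 5) (s := convexPosition 5)
    (f := fun z => 1 - (∑ e : Fin 5, innerCount (z ∘ e.succAbove)) / 2 + innerPairCount z / 2)
    ((measurable_const.sub ((Finset.measurable_sum _ fun e _ => hmeas e).div_const 2)).add
      (measurable_innerPairCount.div_const 2)) (by
      filter_upwards [ae_genPos (n := 5) (cond_volume_absolutelyContinuous (K := K))] with z hz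
      have := two_mul_indicator_convexIndependent_five hz
      classical
      change (if ConvexIndependent ℝ z then (1 : ℝ) else 0) = _
      linarith)
  have hmarg : ∀ e : Fin 5, ∫ z, innerCount (z ∘ e.succAbove) ∂(uniformLaw K 5) =
      ∫ z, innerCount z ∂(uniformLaw K 4) := fun e => integral_comp_succAbove e innerCount
  have hsub : Integrable (fun z : Fin 5 → ℝ × ℝ =>
      1 - (∑ e : Fin 5, innerCount (z ∘ e.succAbove)) / 2) (uniformLaw K 5) :=
    (integrable_const _).sub (hsum.div_const 2)
  rw [Q, h, integral_add hsub (hint2.div_const 2),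
    integral_sub (integrable_const _) (hsum.div_const 2), integral_div, integral_div,
    integral_finsetSum _ fun e _ => hint e]
  simp_rw [hmarg]
  rw [integral_innerPairCount hK hc h0 htop, integral_innerCount hK hc h0 htop]
  simp
  ring

end Probability

/-! ### Integrals over centred boxes -/

/-- Lebesgue measure on the interval of length `w` centred at the origin. -/
noncomputable def centeredVolume (w : ℝ) : Measure ℝ :=
  volume.restrict (Set.Icc (-(w / 2)) (w / 2))

instance (w : ℝ) : IsFiniteMeasure (centeredVolume w) := by
  unfold centeredVolume; infer_instance

/-- The integrand `|t| - κ t²`, whose expectation governs the probabilities of convex position. -/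
def absSubSq (κ t : ℝ) : ℝ := |t| - κ * t ^ 2

theorem continuous_absSubSq (κ : ℝ) : Continuous (absSubSq κ) := by
  unfold absSubSq; fun_prop

theorem integrable_pi_centeredVolume {n : ℕ} (w : Fin n → ℝ) {f : (Fin n → ℝ) → ℝ}
    (hf : Continuous f) : Integrable f (Measure.pi fun i => centeredVolume (w i)) := by
  unfold centeredVolume
  rw [← Measure.restrict_pi_pi, ← volume_pi]
  exact hf.continuousOn.integrableOn_compact (isCompact_univ_pi fun i => isCompact_Icc)

theorem ae_mem_pi_centeredVolume {n : ℕ} (w : Fin n → ℝ) :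
    ∀ᵐ v ∂(Measure.pi fun i => centeredVolume (w i)), ∀ i, |v i| ≤ w i / 2 := by
  rw [ae_all_iff]
  intro i
  refine (Measure.quasiMeasurePreserving_eval (fun i => centeredVolume (w i)) i).ae
    (p := fun x => |x| ≤ w i / 2) ?_
  unfold centeredVolume
  filter_upwards [ae_restrict_mem measurableSet_Icc] with x hx
  exact abs_le.2 hx

theorem measurePreserving_neg_centeredVolume (w : ℝ) :
    MeasurePreserving Neg.neg (centeredVolume w) (centeredVolume w) := by
  have h := (Measure.measurePreserving_neg (volume : Measure ℝ)).restrict_preimage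
    (s := Set.Icc (-(w / 2)) (w / 2)) measurableSet_Icc
  have : Neg.neg ⁻¹' Set.Icc (-(w / 2)) (w / 2) = Set.Icc (-(w / 2)) (w / 2) := by
    ext x; simp [neg_le, and_comm]
  rw [this] at h
  exact h

theorem integral_pi_centeredVolume_eq_zero {n : ℕ} (w : Fin n → ℝ) {f : (Fin n → ℝ) → ℝ}
    (hf : ∀ v, f (-v) = - f v) : ∫ v, f v ∂(Measure.pi fun i => centeredVolume (w i)) = 0 := by
  have hmp : MeasurePreserving (fun v : Fin n → ℝ => -v)
      (Measure.pi fun i => centeredVolume (w i)) (Measure.pi fun i => centeredVolume (w i)) :=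
    measurePreserving_pi _ _ fun i => measurePreserving_neg_centeredVolume (w i)
  have h := hmp.integral_comp (MeasurableEquiv.neg (Fin n → ℝ)).measurableEmbedding f
  simp only [hf, integral_neg] at h
  linarith

theorem integral_centeredVolume {w : ℝ} (hw : 0 ≤ w) (f : ℝ → ℝ) :
    ∫ x, f x ∂(centeredVolume w) = ∫ x in -(w / 2)..w / 2, f x := by
  rw [centeredVolume, integral_Icc_eq_integral_Ioc, intervalIntegral.integral_of_le (by linarith)]

theorem integral_mul_add (a s u v : ℝ) :
    ∫ x in u..v, (a * x + s) = a * (v ^ 2 - u ^ 2) / 2 + s * (v - u) := by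
  rw [intervalIntegral.integral_add (Continuous.intervalIntegrable (by fun_prop) _ _) (by simp),
    intervalIntegral.integral_const_mul, integral_id, intervalIntegral.integral_const, smul_eq_mul]
  ring

theorem integral_abs_mul_add {a w s : ℝ} (ha : 0 < a) (hs : |s| ≤ a * w / 2) :
    ∫ x in -(w / 2)..w / 2, |a * x + s| = a * w ^ 2 / 4 + s ^ 2 / a := by
  have h1 := (abs_le.1 hs).1
  have h2 := (abs_le.1 hs).2
  have hc : Continuous fun x : ℝ => |a * x + s| := by fun_prop
  have hl : -(w / 2) ≤ -s / a := by rw [le_div_iff₀ ha]; linarith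
  have hr : -s / a ≤ w / 2 := by rw [div_le_iff₀ ha]; linarith
  rw [← intervalIntegral.integral_add_adjacent_intervals (b := -s / a)
    (hc.intervalIntegrable _ _) (hc.intervalIntegrable _ _)]
  have e1 : ∫ x in -(w / 2)..-s / a, |a * x + s| = ∫ x in -(w / 2)..-s / a, -(a * x + s) := by
    refine intervalIntegral.integral_congr fun x hx => ?_
    rw [Set.uIcc_of_le hl] at hx
    have := (le_div_iff₀ ha).1 hx.2
    exact abs_of_nonpos (by linarith)
  have e2 : ∫ x in -s / a..w / 2, |a * x + s| = ∫ x in -s / a..w / 2, (a * x + s) := by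
    refine intervalIntegral.integral_congr fun x hx => ?_
    rw [Set.uIcc_of_le hr] at hx
    have := (div_le_iff₀ ha).1 hx.1
    exact abs_of_nonneg (by linarith)
  rw [e1, e2, intervalIntegral.integral_neg, integral_mul_add, integral_mul_add]
  field_simp
  ring

theorem integral_mul_add_sq (a w s : ℝ) :
    ∫ x in -(w / 2)..w / 2, (a * x + s) ^ 2 = a ^ 2 * w ^ 3 / 12 + s ^ 2 * w := by
  have : ∀ x : ℝ, (a * x + s) ^ 2 = a ^ 2 * x ^ 2 + (2 * a * s * x + s ^ 2) := fun x => by ring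
  simp_rw [this]
  rw [intervalIntegral.integral_add (Continuous.intervalIntegrable (by fun_prop) _ _)
    (Continuous.intervalIntegrable (by fun_prop) _ _), intervalIntegral.integral_const_mul,
    integral_pow, integral_mul_add]
  norm_num
  ring

/-- As long as the zero of the affine form stays inside the interval, the integral of `absSubSq`
along it is quadratic in the offset. -/
theorem integral_absSubSq {a w s : ℝ} (κ : ℝ) (ha : a ≠ 0) (hw : 0 ≤ w) (hs : |s| ≤ |a| * w / 2) :
    ∫ x, absSubSq κ (a * x + s) ∂(centeredVolume w) =
      (|a| * w ^ 2 / 4 - κ * (a ^ 2 * w ^ 3 / 12)) + (1 / |a| - κ * w) * s ^ 2 := by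
  have habs : ∫ x in -(w / 2)..w / 2, |a * x + s| = |a| * w ^ 2 / 4 + s ^ 2 / |a| := by
    rcases ha.lt_or_gt with h | h
    · rw [abs_of_neg h] at hs ⊢
      have := integral_abs_mul_add (s := -s) (neg_pos.2 h) (by rwa [abs_neg])
      rw [neg_sq] at this
      rw [← this]
      refine intervalIntegral.integral_congr fun x _ => ?_
      show |a * x + s| = |-a * x + -s|
      rw [← abs_neg]; congr 1; ring
    · rw [abs_of_pos h] at hs ⊢
      exact integral_abs_mul_add h hs
  unfold absSubSq
  rw [integral_centeredVolume hw, intervalIntegral.integral_sub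
    (Continuous.intervalIntegrable (by fun_prop) _ _)
    (Continuous.intervalIntegrable (by fun_prop) _ _), habs, intervalIntegral.integral_const_mul,
    integral_mul_add_sq]
  ring

/-- When one coordinate dominates, the integral of `absSubSq` of an affine form over a centred box is
quadratic in the offset `d`; the first summand on the right does not depend on `d`. -/
theorem integral_pi_absSubSq {n : ℕ} (a w : Fin (n + 1) → ℝ) (hw : ∀ i, 0 ≤ w i) (m : Fin (n + 1))
    (κ : ℝ) (ham : a m ≠ 0) {d : ℝ}
    (hd : 2 * |d| + ∑ i, |a (m.succAbove i)| * w (m.succAbove i) ≤ |a m| * w m) :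
    ∫ v, absSubSq κ (∑ i, a i * v i + d) ∂(Measure.pi fun i => centeredVolume (w i)) =
      ∫ v, (|a m| * w m ^ 2 / 4 - κ * (a m ^ 2 * w m ^ 3 / 12) + (1 / |a m| - κ * w m) *
          (∑ i, a (m.succAbove i) * v i) ^ 2)
        ∂(Measure.pi fun i => centeredVolume (w (m.succAbove i))) +
      (1 / |a m| - κ * w m) * d ^ 2 *
        (Measure.pi fun i => centeredVolume (w (m.succAbove i))).real Set.univ := by
  have hmp := measurePreserving_piFinSuccAbove (fun i => centeredVolume (w i)) m
  have hG : ∀ v : Fin (n + 1) → ℝ, absSubSq κ (∑ i, a i * v i + d) =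
      (fun y : ℝ × (Fin n → ℝ) => absSubSq κ (a m * y.1 +
        (∑ i, a (m.succAbove i) * y.2 i + d))) (MeasurableEquiv.piFinSuccAbove (fun _ => ℝ) m v) := by
    intro v
    rw [Fin.sum_univ_succAbove _ m, add_assoc]
    rfl
  have hint : Integrable (fun y : ℝ × (Fin n → ℝ) => absSubSq κ (a m * y.1 +
        (∑ i, a (m.succAbove i) * y.2 i + d))) ((centeredVolume (w m)).prod
          (Measure.pi fun i => centeredVolume (w (m.succAbove i)))) := by
    rw [← hmp.integrable_comp_emb (MeasurableEquiv.measurableEmbedding _)]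
    refine (integrable_pi_centeredVolume w (f := fun v => absSubSq κ (∑ i, a i * v i + d))
      ((continuous_absSubSq κ).comp (by fun_prop))).congr ?_
    exact Filter.Eventually.of_forall hG
  refine (integral_congr_ae (Filter.Eventually.of_forall hG)).trans
    ((hmp.integral_comp' (fun y : ℝ × (Fin n → ℝ) => absSubSq κ (a m * y.1 +
        (∑ i, a (m.succAbove i) * y.2 i + d)))).trans ?_)
  rw [integral_prod_symm _ hint]
  have hinner : ∀ᵐ v ∂(Measure.pi fun i => centeredVolume (w (m.succAbove i))),
      ∫ x, absSubSq κ (a m * x + (∑ i, a (m.succAbove i) * v i + d)) ∂(centeredVolume (w m)) =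
      (|a m| * w m ^ 2 / 4 - κ * (a m ^ 2 * w m ^ 3 / 12) + (1 / |a m| - κ * w m) *
          (∑ i, a (m.succAbove i) * v i) ^ 2) + ((1 / |a m| - κ * w m) * d ^ 2 +
          (1 / |a m| - κ * w m) * (2 * d) * (∑ i, a (m.succAbove i) * v i)) := by
    filter_upwards [ae_mem_pi_centeredVolume fun i => w (m.succAbove i)] with v hv
    rw [integral_absSubSq κ ham (hw m)]
    · ring
    · have h1 : |∑ i, a (m.succAbove i) * v i| ≤
          ∑ i, |a (m.succAbove i)| * (w (m.succAbove i) / 2) :=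
        (Finset.abs_sum_le_sum_abs _ _).trans (Finset.sum_le_sum fun i _ => by
          rw [abs_mul]; exact mul_le_mul_of_nonneg_left (hv i) (abs_nonneg _))
      have h2 : ∑ i, |a (m.succAbove i)| * (w (m.succAbove i) / 2) =
          (∑ i, |a (m.succAbove i)| * w (m.succAbove i)) / 2 := by
        rw [Finset.sum_div]; exact Finset.sum_congr rfl fun i _ => by ring
      have h3 := abs_add_le (∑ i, a (m.succAbove i) * v i) d
      linarith
  -- the term linear in `d` is odd in the remaining coordinates and integrates to zero
  have hodd : ∫ v, ((1 / |a m| - κ * w m) * d ^ 2 + (1 / |a m| - κ * w m) * (2 * d) *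
        (∑ i, a (m.succAbove i) * v i))
        ∂(Measure.pi fun i => centeredVolume (w (m.succAbove i))) =
      (1 / |a m| - κ * w m) * d ^ 2 *
        (Measure.pi fun i => centeredVolume (w (m.succAbove i))).real Set.univ := by
    rw [integral_add (integrable_const _) (integrable_pi_centeredVolume _ (by fun_prop)),
      integral_const, integral_const_mul, integral_pi_centeredVolume_eq_zero _ (fun v => by simp),
      smul_eq_mul]
    ring
  rw [integral_congr_ae hinner, integral_add (integrable_pi_centeredVolume _ (by fun_prop))
    (integrable_pi_centeredVolume _ (by fun_prop)), hodd]

/-- Moving the offset of an affine form away from zero increases the integral of `absSubSq` over a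
centred box, as long as one coordinate dominates. -/
theorem integral_pi_absSubSq_mono {n : ℕ} (a w : Fin (n + 1) → ℝ) (hw : ∀ i, 0 ≤ w i)
    (m : Fin (n + 1)) {κ : ℝ} (hκ : κ * (|a m| * w m) ≤ 1) {d d' : ℝ} (hdd : |d| ≤ |d'|)
    (hd : 2 * |d'| + ∑ i, |a (m.succAbove i)| * w (m.succAbove i) ≤ |a m| * w m) :
    ∫ v, absSubSq κ (∑ i, a i * v i + d) ∂(Measure.pi fun i => centeredVolume (w i)) ≤
      ∫ v, absSubSq κ (∑ i, a i * v i + d') ∂(Measure.pi fun i => centeredVolume (w i)) := by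
  -- a vanishing dominant coefficient forces both offsets to vanish
  by_cases ham : a m = 0
  · have hsum : 0 ≤ ∑ i, |a (m.succAbove i)| * w (m.succAbove i) :=
      Finset.sum_nonneg fun i _ => mul_nonneg (abs_nonneg _) (hw _)
    rw [ham] at hd
    have h' : d' = 0 := by
      rw [← abs_nonpos_iff]; simp at hd; linarith
    have h0 : d = 0 := by rw [h'] at hdd; simpa using hdd
    rw [h', h0]
  · rw [integral_pi_absSubSq a w hw m κ ham (by linarith),
      integral_pi_absSubSq a w hw m κ ham hd]
    have hpos : 0 < |a m| := abs_pos.2 ham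
    have hK : 0 ≤ 1 / |a m| - κ * w m := by
      rw [sub_nonneg, le_div_iff₀ hpos]; linarith
    have := sq_le_sq.2 hdd
    gcongr

section Integrability

variable {K : Set (ℝ × ℝ)}

/-- The relative area of a random triangle is almost surely the probability of a set, hence bounded
by `1`; boundedness of `K` is not needed. -/
theorem integrable_area (hK : MeasurableSet K) (hc : Convex ℝ K) (h0 : volume K ≠ 0)
    (htop : volume K ≠ ⊤) :
    Integrable (fun t : Fin 3 → ℝ × ℝ => |orient (t 0) (t 1) (t 2)| / (2 * volume.real K))
        (uniformLaw K 3) ∧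
      Integrable (fun t : Fin 3 → ℝ × ℝ =>
        (|orient (t 0) (t 1) (t 2)| / (2 * volume.real K)) ^ 2) (uniformLaw K 3) := by
  have := isProbabilityMeasure_cond_volume h0 htop
  have hp : IsProbabilityMeasure (uniformLaw K 3) := by unfold uniformLaw; infer_instance
  have hm : Measurable fun t : Fin 3 → ℝ × ℝ =>
      |orient (t 0) (t 1) (t 2)| / (2 * volume.real K) :=
    (Measurable.orient (by fun_prop) (by fun_prop) (by fun_prop)).abs.div_const _
  have hb : ∀ᵐ t ∂(uniformLaw K 3),
      ‖|orient (t 0) (t 1) (t 2)| / (2 * volume.real K)‖ ≤ 1 := by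
    filter_upwards [ae_cond_real_inTri hK hc h0 htop] with t ht
    rw [← ht, Real.norm_of_nonneg measureReal_nonneg]
    exact measureReal_le_one
  refine ⟨Integrable.of_bound hm.aestronglyMeasurable 1 hb,
    Integrable.of_bound (hm.pow_const 2).aestronglyMeasurable 1 ?_⟩
  filter_upwards [hb] with t ht
  rw [norm_pow]
  exact pow_le_one₀ (norm_nonneg _) ht

theorem volume_real_pos (h0 : volume K ≠ 0) (htop : volume K ≠ ⊤) : 0 < volume.real K :=
  ENNReal.toReal_pos h0 htop

theorem integrable_absSubSq_orient (hK : MeasurableSet K) (hc : Convex ℝ K) (h0 : volume K ≠ 0)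
    (htop : volume K ≠ ⊤) (κ : ℝ) :
    Integrable (fun t : Fin 3 → ℝ × ℝ => absSubSq κ (orient (t 0) (t 1) (t 2)))
      (uniformLaw K 3) := by
  obtain ⟨h1, h2⟩ := integrable_area hK hc h0 htop
  have hA := volume_real_pos h0 htop
  refine ((h1.mul_const (2 * volume.real K)).sub
    (h2.mul_const (κ * (2 * volume.real K) ^ 2))).congr (Filter.Eventually.of_forall fun t => ?_)
  simp only [absSubSq, Pi.sub_apply, div_pow, sq_abs]
  field_simp

theorem Q_four_eq (hK : MeasurableSet K) (hc : Convex ℝ K) (h0 : volume K ≠ 0)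
    (htop : volume K ≠ ⊤) :
    Q 4 K = 1 - 4 / (2 * volume.real K) *
      ∫ t, absSubSq 0 (orient (t 0) (t 1) (t 2)) ∂(uniformLaw K 3) := by
  rw [Q_four hK hc h0 htop, integral_div]
  simp only [absSubSq, zero_mul, sub_zero]
  ring

theorem Q_five_eq (hK : MeasurableSet K) (hc : Convex ℝ K) (h0 : volume K ≠ 0)
    (htop : volume K ≠ ⊤) :
    Q 5 K = 1 - 10 / (2 * volume.real K) *
      ∫ t, absSubSq (1 / (2 * volume.real K)) (orient (t 0) (t 1) (t 2)) ∂(uniformLaw K 3) := by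
  obtain ⟨h1, h2⟩ := integrable_area hK hc h0 htop
  have hA := volume_real_pos h0 htop
  have : ∀ t : Fin 3 → ℝ × ℝ,
      |orient (t 0) (t 1) (t 2)| / (2 * volume.real K) -
        (|orient (t 0) (t 1) (t 2)| / (2 * volume.real K)) ^ 2 = 1 / (2 * volume.real K) *
      absSubSq (1 / (2 * volume.real K)) (orient (t 0) (t 1) (t 2)) := by
    intro t
    simp only [absSubSq, div_pow, sq_abs]
    field_simp
  have h3 := integral_sub h1 h2
  simp_rw [this, integral_const_mul] at h3
  rw [Q_five hK hc h0 htop]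
  linear_combination 10 * h3

end Integrability

/-! ### Sections of a compact convex set -/

section Geometry

variable {H : Set (ℝ × ℝ)}

theorem image_fst_eq_Icc (hH : IsCCS H) : Prod.fst '' H = Set.Icc (xMin H) (xMax H) := by
  have hne : H.Nonempty := hH.2.2.mono interior_subset
  exact eq_Icc_of_connected_compact
    ((hH.2.1.isConnected hne).image _ continuous_fst.continuousOn) (hH.1.image continuous_fst)

theorem section_eq_Icc (hH : IsCCS H) {x : ℝ} (hx : x ∈ Set.Icc (xMin H) (xMax H)) :
    {y | (x, y) ∈ H} = Set.Icc (yLow H x) (yHigh H x) := by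
  rw [← image_fst_eq_Icc hH] at hx
  obtain ⟨⟨x, y⟩, hp, rfl⟩ := hx
  have hconv : Convex ℝ {y | (x, y) ∈ H} := by
    intro y₁ h₁ y₂ h₂ s t hs ht hst
    have := hH.2.1 h₁ h₂ hs ht hst
    simpa [← add_mul, hst] using this
  have hcomp : IsCompact {y | (x, y) ∈ H} := by
    have : {y | (x, y) ∈ H} = Prod.snd '' (H ∩ {p | p.1 = x}) := by
      ext y; simp
    rw [this]
    exact (hH.1.inter_right (isClosed_eq continuous_fst continuous_const)).image continuous_snd
  exact eq_Icc_of_connected_compact (hconv.isConnected ⟨y, hp⟩) hcomp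

theorem mem_iff_of_mem_Icc (hH : IsCCS H) {x : ℝ} (hx : x ∈ Set.Icc (xMin H) (xMax H)) (y : ℝ) :
    (x, y) ∈ H ↔ yLow H x ≤ y ∧ y ≤ yHigh H x := by
  have := section_eq_Icc hH hx
  rw [Set.ext_iff] at this
  exact this y

theorem fst_mem_Icc (hH : IsCCS H) {p : ℝ × ℝ} (hp : p ∈ H) :
    p.1 ∈ Set.Icc (xMin H) (xMax H) := by
  rw [← image_fst_eq_Icc hH]; exact ⟨p, hp, rfl⟩

theorem yLow_le_yHigh (hH : IsCCS H) {x : ℝ} (hx : x ∈ Set.Icc (xMin H) (xMax H)) :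
    yLow H x ≤ yHigh H x := by
  rw [← image_fst_eq_Icc hH] at hx
  obtain ⟨p, hp, rfl⟩ := hx
  have := (mem_iff_of_mem_Icc hH (fst_mem_Icc hH hp) p.2).1 hp
  exact this.1.trans this.2

theorem concaveOn_yHigh (hH : IsCCS H) :
    ConcaveOn ℝ (Set.Icc (xMin H) (xMax H)) (yHigh H) := by
  refine ⟨convex_Icc _ _, fun x hx y hy s t hs ht hst => ?_⟩
  have h1 := (mem_iff_of_mem_Icc hH hx _).2 ⟨yLow_le_yHigh hH hx, le_rfl⟩
  have h2 := (mem_iff_of_mem_Icc hH hy _).2 ⟨yLow_le_yHigh hH hy, le_rfl⟩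
  exact ((mem_iff_of_mem_Icc hH (convex_Icc _ _ hx hy hs ht hst) _).1
    (hH.2.1 h1 h2 hs ht hst)).2

theorem convexOn_yLow (hH : IsCCS H) :
    ConvexOn ℝ (Set.Icc (xMin H) (xMax H)) (yLow H) := by
  refine ⟨convex_Icc _ _, fun x hx y hy s t hs ht hst => ?_⟩
  have h1 := (mem_iff_of_mem_Icc hH hx _).2 ⟨le_rfl, yLow_le_yHigh hH hx⟩
  have h2 := (mem_iff_of_mem_Icc hH hy _).2 ⟨le_rfl, yLow_le_yHigh hH hy⟩
  exact ((mem_iff_of_mem_Icc hH (convex_Icc _ _ hx hy hs ht hst) _).1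
    (hH.2.1 h1 h2 hs ht hst)).1

theorem width_of_mem {x : ℝ} (hx : x ∈ Set.Icc (xMin H) (xMax H)) :
    width H x = yHigh H x - yLow H x := Set.indicator_of_mem hx _

theorem concaveOn_width (hH : IsCCS H) :
    ConcaveOn ℝ (Set.Icc (xMin H) (xMax H)) (width H) :=
  ((concaveOn_yHigh hH).sub (convexOn_yLow hH)).congr fun _ hx => (width_of_mem hx).symm

theorem width_nonneg (hH : IsCCS H) (x : ℝ) : 0 ≤ width H x :=
  Set.indicator_nonneg (fun _ hx => sub_nonneg.2 (yLow_le_yHigh hH hx)) x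

/-- The ordinate of the middle of the vertical section of `H`, zero outside the projection
of `H`. -/
noncomputable def midOrdinate (H : Set (ℝ × ℝ)) : ℝ → ℝ :=
  (Set.Icc (xMin H) (xMax H)).indicator fun x => (yHigh H x + yLow H x) / 2

theorem midOrdinate_of_mem {x : ℝ} (hx : x ∈ Set.Icc (xMin H) (xMax H)) :
    midOrdinate H x = (yHigh H x + yLow H x) / 2 := Set.indicator_of_mem hx _

/-- The superlevel sets of the upper boundary are projections of compact sets. -/
theorem measurable_indicator_yHigh (hH : IsCCS H) :
    Measurable ((Set.Icc (xMin H) (xMax H)).indicator (yHigh H)) := by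
  refine measurable_of_Ici fun a => ?_
  rw [Set.indicator_preimage]
  have : yHigh H ⁻¹' Set.Ici a ∩ Set.Icc (xMin H) (xMax H) = Prod.fst '' (H ∩ {p | a ≤ p.2}) := by
    ext x
    constructor
    · rintro ⟨h1, hx⟩
      exact ⟨(x, yHigh H x), ⟨(mem_iff_of_mem_Icc hH hx _).2 ⟨yLow_le_yHigh hH hx, le_rfl⟩, h1⟩,
        rfl⟩
    · rintro ⟨p, ⟨hp, ha⟩, rfl⟩
      have hx := fst_mem_Icc hH hp
      exact ⟨ha.trans ((mem_iff_of_mem_Icc hH hx p.2).1 hp).2, hx⟩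
  have hm : MeasurableSet (Prod.fst '' (H ∩ {p : ℝ × ℝ | a ≤ p.2})) :=
    ((hH.1.inter_right (isClosed_le continuous_const continuous_snd)).image
      continuous_fst).measurableSet
  rw [Set.ite, this]
  exact hm.union ((measurable_const measurableSet_Ici).diff measurableSet_Icc)

theorem measurable_indicator_yLow (hH : IsCCS H) :
    Measurable ((Set.Icc (xMin H) (xMax H)).indicator (yLow H)) := by
  refine measurable_of_Iic fun a => ?_
  rw [Set.indicator_preimage]
  have : yLow H ⁻¹' Set.Iic a ∩ Set.Icc (xMin H) (xMax H) = Prod.fst '' (H ∩ {p | p.2 ≤ a}) := by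
    ext x
    constructor
    · rintro ⟨h1, hx⟩
      exact ⟨(x, yLow H x), ⟨(mem_iff_of_mem_Icc hH hx _).2 ⟨le_rfl, yLow_le_yHigh hH hx⟩, h1⟩,
        rfl⟩
    · rintro ⟨p, ⟨hp, ha⟩, rfl⟩
      have hx := fst_mem_Icc hH hp
      exact ⟨((mem_iff_of_mem_Icc hH hx p.2).1 hp).1.trans ha, hx⟩
  have hm : MeasurableSet (Prod.fst '' (H ∩ {p : ℝ × ℝ | p.2 ≤ a})) :=
    ((hH.1.inter_right (isClosed_le continuous_snd continuous_const)).image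
      continuous_fst).measurableSet
  rw [Set.ite, this]
  exact hm.union ((measurable_const measurableSet_Iic).diff measurableSet_Icc)

theorem measurable_width (hH : IsCCS H) : Measurable (width H) := by
  convert (measurable_indicator_yHigh hH).sub (measurable_indicator_yLow hH) using 1
  ext x
  simp only [width, Set.indicator, Pi.sub_apply]
  split_ifs <;> simp

theorem measurable_midOrdinate (hH : IsCCS H) : Measurable (midOrdinate H) := by
  convert ((measurable_indicator_yHigh hH).add (measurable_indicator_yLow hH)).div_const 2 using 1
  ext x
  simp only [midOrdinate, Set.indicator, Pi.add_apply]
  split_ifs <;> simp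

theorem measurableSet_steinerSymm (hH : IsCCS H) : MeasurableSet (steinerSymm H) := by
  have hw : Measurable fun p : ℝ × ℝ => width H p.1 := (measurable_width hH).comp measurable_fst
  exact (measurableSet_le measurable_const measurable_fst).inter
    ((measurableSet_le measurable_fst measurable_const).inter
    (measurableSet_le (measurable_snd.abs) (hw.div_const 2)))

theorem measurableSet_shaking (hH : IsCCS H) : MeasurableSet (shaking H) := by
  have hw : Measurable fun p : ℝ × ℝ => width H p.1 := (measurable_width hH).comp measurable_fst
  exact (measurableSet_le measurable_const measurable_fst).inter
    ((measurableSet_le measurable_fst measurable_const).inter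
    ((measurableSet_le measurable_const measurable_snd).inter
    (measurableSet_le measurable_snd hw)))

theorem convex_steinerSymm (hH : IsCCS H) : Convex ℝ (steinerSymm H) := by
  rintro p ⟨hp1, hp2, hp3⟩ q ⟨hq1, hq2, hq3⟩ s t hs ht hst
  have hI := convex_Icc (𝕜 := ℝ) (xMin H) (xMax H) ⟨hp1, hp2⟩ ⟨hq1, hq2⟩ hs ht hst
  have hw := (concaveOn_width hH).2 ⟨hp1, hp2⟩ ⟨hq1, hq2⟩ hs ht hst
  refine ⟨hI.1, hI.2, ?_⟩
  simp only [smul_eq_mul, Prod.fst_add, Prod.snd_add, Prod.smul_fst, Prod.smul_snd] at hw ⊢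
  rw [abs_le] at *
  constructor <;> nlinarith

theorem convex_shaking (hH : IsCCS H) : Convex ℝ (shaking H) := by
  rintro p ⟨hp1, hp2, hp3, hp4⟩ q ⟨hq1, hq2, hq3, hq4⟩ s t hs ht hst
  have hI := convex_Icc (𝕜 := ℝ) (xMin H) (xMax H) ⟨hp1, hp2⟩ ⟨hq1, hq2⟩ hs ht hst
  have hw := (concaveOn_width hH).2 ⟨hp1, hp2⟩ ⟨hq1, hq2⟩ hs ht hst
  refine ⟨hI.1, hI.2, ?_⟩
  simp only [smul_eq_mul, Prod.fst_add, Prod.snd_add, Prod.smul_fst, Prod.smul_snd] at hw ⊢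
  constructor
  · positivity
  · nlinarith

theorem ofReal_abs_orient_le_volume (a b c : ℝ × ℝ) :
    ENNReal.ofReal (|orient a b c| / 2) ≤ volume (convexHull ℝ {a, b, c}) := by
  by_cases h : orient a b c = 0
  · simp [h]
  · rw [← setOf_inTri_eq_convexHull h, volume_inTri h]

/-- A chord of a convex set spans, together with two of its points on either side, two triangles
contained in the set. -/
theorem sub_mul_width_le (hH : IsCCS H) {u v w : ℝ} (huv : u ≤ v) (hvw : v ≤ w)
    (hu : u ∈ Set.Icc (xMin H) (xMax H)) (hw : w ∈ Set.Icc (xMin H) (xMax H)) :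
    (w - u) * width H v ≤ 2 * volume.real H := by
  have hv : v ∈ Set.Icc (xMin H) (xMax H) := ⟨hu.1.trans huv, hvw.trans hw.2⟩
  have hlo := (mem_iff_of_mem_Icc hH hv _).2 ⟨le_rfl, yLow_le_yHigh hH hv⟩
  have hhi := (mem_iff_of_mem_Icc hH hv _).2 ⟨yLow_le_yHigh hH hv, le_rfl⟩
  have hup := (mem_iff_of_mem_Icc hH hu _).2 ⟨le_rfl, yLow_le_yHigh hH hu⟩
  have hwp := (mem_iff_of_mem_Icc hH hw _).2 ⟨le_rfl, yLow_le_yHigh hH hw⟩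
  have hwn := width_nonneg hH v
  set A := convexHull ℝ {(u, yLow H u), (v, yLow H v), (v, yHigh H v)} with hA
  set B := convexHull ℝ {(w, yLow H w), (v, yLow H v), (v, yHigh H v)} with hB
  have hsub : A ∪ B ⊆ H := by
    refine Set.union_subset (convexHull_min ?_ hH.2.1) (convexHull_min ?_ hH.2.1) <;>
      rintro p (rfl | rfl | rfl) <;> assumption
  have hAl : A ⊆ {p | p.1 ≤ v} := by
    refine convexHull_min ?_ (convex_halfSpace_le (LinearMap.fst ℝ ℝ ℝ).isLinear v)
    rintro p (rfl | rfl | rfl) <;> simp [huv]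
  have hBr : B ⊆ {p | v ≤ p.1} := by
    refine convexHull_min ?_ (convex_halfSpace_ge (LinearMap.fst ℝ ℝ ℝ).isLinear v)
    rintro p (rfl | rfl | rfl) <;> simp [hvw]
  have hd : AEDisjoint volume A B :=
    measure_mono_null (fun p hp => le_antisymm (hAl hp.1) (hBr hp.2)) (volume_setOf_fst_eq v)
  have hBm : MeasurableSet B := by
    rw [hB]
    exact ((Set.toFinite _).isCompact_convexHull (𝕜 := ℝ)).measurableSet
  have hvol : ENNReal.ofReal ((v - u) * width H v / 2) + ENNReal.ofReal ((w - v) * width H v / 2)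
      ≤ volume H := by
    refine le_trans ?_ (measure_mono hsub)
    rw [measure_union₀ hBm.nullMeasurableSet hd]
    refine add_le_add ?_ ?_
    · refine le_trans (ENNReal.ofReal_le_ofReal (le_of_eq ?_)) (ofReal_abs_orient_le_volume _ _ _)
      rw [width_of_mem hv] at hwn ⊢
      rw [abs_of_nonneg] <;> simp only [orient] <;> nlinarith
    · refine le_trans (ENNReal.ofReal_le_ofReal (le_of_eq ?_)) (ofReal_abs_orient_le_volume _ _ _)
      rw [width_of_mem hv] at hwn ⊢
      rw [abs_of_nonpos] <;> simp only [orient] <;> nlinarith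
  rw [← ENNReal.ofReal_add (by nlinarith) (by nlinarith),
    ENNReal.ofReal_le_iff_le_toReal hH.1.measure_lt_top.ne] at hvol
  rw [Measure.real]
  linarith

theorem ConcaveOn.three_points {s : Set ℝ} {f : ℝ → ℝ} (hf : ConcaveOn ℝ s f) {u v w : ℝ}
    (hu : u ∈ s) (hw : w ∈ s) (huv : u ≤ v) (hvw : v ≤ w) :
    (w - v) * f u + (v - u) * f w ≤ (w - u) * f v := by
  rcases (huv.trans hvw).eq_or_lt with h | h
  · subst h
    obtain rfl := le_antisymm huv hvw
    simp
  · have hpos : 0 < w - u := sub_pos.2 h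
    have := hf.2 hu hw (div_nonneg (sub_nonneg.2 hvw) hpos.le)
      (div_nonneg (sub_nonneg.2 huv) hpos.le) (by field_simp; ring)
    have hv : ((w - v) / (w - u)) • u + ((v - u) / (w - u)) • w = v := by
      simp only [smul_eq_mul]; field_simp; ring
    rw [hv, smul_eq_mul, smul_eq_mul] at this
    calc _ = (w - u) * ((w - v) / (w - u) * f u + (v - u) / (w - u) * f w) := by field_simp
      _ ≤ _ := mul_le_mul_of_nonneg_left this hpos.le

end Geometry

/-! ### Shears and conditioning on the abscissas -/

/-- The vertical shear by a function `c` of the abscissa. -/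
def shear (c : ℝ → ℝ) (p : ℝ × ℝ) : ℝ × ℝ := (p.1, p.2 + c p.1)

theorem measurePreserving_shear {c : ℝ → ℝ} (hc : Measurable c) :
    MeasurePreserving (shear c) (volume : Measure (ℝ × ℝ)) volume :=
  (MeasurePreserving.id (volume : Measure ℝ)).skew_product (μc := (volume : Measure ℝ))
    (μd := (volume : Measure ℝ)) (g := fun x y => y + c x)
    (measurable_snd.add (hc.comp measurable_fst))
    (Filter.Eventually.of_forall fun x => (measurePreserving_add_right volume (c x)).map_eq)

theorem measurePreserving_shear_cond {c : ℝ → ℝ} (hc : Measurable c) {S K : Set (ℝ × ℝ)}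
    (hK : MeasurableSet K) (hS : shear c ⁻¹' K = S) :
    MeasurePreserving (shear c) (cond volume S) (cond volume K) := by
  have hmp := measurePreserving_shear hc
  have hvol : volume S = volume K := by
    rw [← hS]; exact hmp.measure_preimage hK.nullMeasurableSet
  have h := hmp.restrict_preimage hK
  rw [hS] at h
  unfold ProbabilityTheory.cond
  rw [hvol]
  exact ⟨h.measurable, by rw [Measure.map_smul, h.map_eq]⟩

theorem pi_smul_measure {n : ℕ} {α : Type*} [MeasurableSpace α] (μ : Measure α) [IsFiniteMeasure μ]
    {c : ENNReal} (hc : c ≠ ⊤) :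
    (Measure.pi fun _ : Fin n => c • μ) = c ^ n • Measure.pi fun _ : Fin n => μ := by
  have : IsFiniteMeasure (c • μ) := Measure.smul_finite μ hc
  refine (Measure.pi_eq fun s hs => ?_)
  simp [Measure.smul_apply, Measure.pi_pi, Finset.prod_mul_distrib]

/-- The coefficients with which the ordinates of three points enter `orient`, as functions of their
abscissas. -/
def orientCoeff (x : Fin 3 → ℝ) : Fin 3 → ℝ := ![x 2 - x 1, x 0 - x 2, x 1 - x 0]

theorem orient_shear (c : ℝ → ℝ) (x v : Fin 3 → ℝ) :
    orient (shear c (x 0, v 0)) (shear c (x 1, v 1)) (shear c (x 2, v 2)) =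
      ∑ i, orientCoeff x i * v i +
        ∑ i, orientCoeff x i * c (x i) := by
  simp only [orient, shear, orientCoeff, Fin.sum_univ_three, Matrix.cons_val_zero, Matrix.cons_val_one,
    Matrix.cons_val]
  ring

section Disintegration

variable {H : Set (ℝ × ℝ)}

/-- Conditioning on the abscissas: given them, the ordinates of independent uniform points of the
Steiner symmetrization are independent and uniform on centred intervals. -/
theorem integral_uniformLaw_steinerSymm_nonneg (hH : IsCCS H) {n : ℕ}
    (h0 : volume (steinerSymm H) ≠ 0)
    (htop : volume (steinerSymm H) ≠ ⊤) {f : (Fin n → ℝ × ℝ) → ℝ}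
    (hf : Integrable f (uniformLaw (steinerSymm H) n))
    (h : ∀ x : Fin n → ℝ, (∀ i, x i ∈ Set.Icc (xMin H) (xMax H)) →
      0 ≤ ∫ v, f (fun i => (x i, v i)) ∂(Measure.pi fun i => centeredVolume (width H (x i)))) :
    0 ≤ ∫ z, f z ∂(uniformLaw (steinerSymm H) n) := by
  set S := steinerSymm H with hS
  have hSm : MeasurableSet S := measurableSet_steinerSymm hH
  have hlaw : uniformLaw S n =
      ((volume S)⁻¹) ^ n • (volume : Measure (Fin n → ℝ × ℝ)).restrict (Set.univ.pi fun _ => S) := by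
    unfold uniformLaw ProbabilityTheory.cond
    have : IsFiniteMeasure ((volume : Measure (ℝ × ℝ)).restrict S) :=
      ⟨by rw [Measure.restrict_apply_univ]; exact htop.lt_top⟩
    rw [pi_smul_measure _ (ENNReal.inv_ne_top.2 h0), volume_pi, Measure.restrict_pi_pi]
  have hbox : MeasurableSet (Set.univ.pi fun _ : Fin n => S) :=
    MeasurableSet.univ_pi fun _ => hSm
  have hc0 : ((volume S)⁻¹) ^ n ≠ 0 := pow_ne_zero _ (ENNReal.inv_ne_zero.2 htop)
  have hct : ((volume S)⁻¹) ^ n ≠ ⊤ := ENNReal.pow_ne_top (ENNReal.inv_ne_top.2 h0)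
  rw [hlaw] at hf ⊢
  rw [integrable_smul_measure hc0 hct] at hf
  rw [integral_smul_measure]
  refine smul_nonneg ENNReal.toReal_nonneg ?_
  rw [← integral_indicator hbox]
  replace hf := (integrable_indicator_iff hbox).2 hf
  have hmp := (volume_measurePreserving_arrowProdEquivProdArrow ℝ ℝ (Fin n)).symm
  rw [← hmp.integral_comp', Measure.volume_eq_prod, integral_prod]
  · refine integral_nonneg fun x => ?_
    by_cases hx : ∀ i, x i ∈ Set.Icc (xMin H) (xMax H)
    · refine (h x hx).trans (le_of_eq ?_)
      unfold centeredVolume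
      rw [← Measure.restrict_pi_pi, ← volume_pi, ← integral_indicator
        (MeasurableSet.univ_pi fun _ => measurableSet_Icc)]
      refine integral_congr_ae (Filter.Eventually.of_forall fun v => ?_)
      have hiff : (v ∈ Set.univ.pi fun i => Set.Icc (-(width H (x i) / 2)) (width H (x i) / 2)) ↔
          (fun i => (x i, v i)) ∈ Set.univ.pi fun _ : Fin n => S := by
        simp only [Set.mem_univ_pi]
        refine forall_congr' fun i => ?_
        constructor
        · exact fun hv => ⟨(hx i).1, (hx i).2, abs_le.2 hv⟩
        · exact fun hv => abs_le.1 hv.2.2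
      by_cases hv : v ∈ Set.univ.pi fun i => Set.Icc (-(width H (x i) / 2)) (width H (x i) / 2)
      · rw [Set.indicator_of_mem hv]
        exact (Set.indicator_of_mem (hiff.1 hv) f).symm
      · rw [Set.indicator_of_notMem hv]
        exact (Set.indicator_of_notMem (fun h' => hv (hiff.2 h')) f).symm
    · refine le_of_eq (Eq.symm ?_)
      refine integral_eq_zero_of_ae (Filter.Eventually.of_forall fun v => ?_)
      refine Set.indicator_of_notMem (fun hv => hx fun i => ?_) f
      have := hv i (Set.mem_univ i)
      exact ⟨this.1, this.2.1⟩
  · exact (hmp.integrable_comp_emb (MeasurableEquiv.measurableEmbedding _)).2 hf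

end Disintegration

/-! ### Comparison of the three sets -/

/-- The index `m` is that of the middle abscissa and `ε` is the sign of its coefficient: the other two
coefficients have the opposite sign, and the three coefficients annihilate affine functions. -/
theorem exists_dominant_coeff (x : Fin 3 → ℝ) :
    ∃ (m : Fin 3) (ε : ℝ), (ε = 1 ∨ ε = -1) ∧ 0 ≤ ε * orientCoeff x m ∧
      (∀ i : Fin 2, ε * orientCoeff x (m.succAbove i) ≤ 0) ∧
      (∀ (s : Set ℝ) (f : ℝ → ℝ), ConcaveOn ℝ s f → (∀ i, x i ∈ s) →
        0 ≤ ε * ∑ i, orientCoeff x i * f (x i)) ∧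
      ∃ i j, x i ≤ x m ∧ x m ≤ x j ∧ ε * orientCoeff x m = x j - x i := by
  have key : ∀ (m p q : Fin 3) (ε : ℝ), (ε = 1 ∨ ε = -1) → x p ≤ x m → x m ≤ x q →
      ε * orientCoeff x m = x q - x p →
      (∀ i : Fin 2, ε * orientCoeff x (m.succAbove i) ≤ 0) →
      (∀ f : ℝ → ℝ, ε * ∑ i, orientCoeff x i * f (x i) =
        (x q - x p) * f (x m) - ((x q - x m) * f (x p) + (x m - x p) * f (x q))) →
      ∃ (m : Fin 3) (ε : ℝ), (ε = 1 ∨ ε = -1) ∧ 0 ≤ ε * orientCoeff x m ∧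
        (∀ i : Fin 2, ε * orientCoeff x (m.succAbove i) ≤ 0) ∧
        (∀ (s : Set ℝ) (f : ℝ → ℝ), ConcaveOn ℝ s f → (∀ i, x i ∈ s) →
          0 ≤ ε * ∑ i, orientCoeff x i * f (x i)) ∧
        ∃ i j, x i ≤ x m ∧ x m ≤ x j ∧ ε * orientCoeff x m = x j - x i := by
    intro m p q ε hε hpm hmq hm hi hf
    refine ⟨m, ε, hε, by rw [hm]; linarith, hi, fun s f hs hx => ?_, p, q, hpm, hmq, hm⟩
    rw [hf]
    linarith [hs.three_points (hx p) (hx q) hpm hmq]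
  rcases le_total (x 0) (x 1) with h01 | h01 <;> rcases le_total (x 1) (x 2) with h12 | h12 <;>
    rcases le_total (x 0) (x 2) with h02 | h02
  · refine key 1 0 2 (-1) (Or.inr rfl) h01 h12 ?_ ?_ ?_
    · simp [orientCoeff]
    · intro i; fin_cases i <;> simp [orientCoeff, Fin.succAbove] <;> assumption
    · intro f; simp [orientCoeff, Fin.sum_univ_three]; ring
  · refine key 1 0 2 (-1) (Or.inr rfl) h01 h12 ?_ ?_ ?_
    · simp [orientCoeff]
    · intro i; fin_cases i <;> simp [orientCoeff, Fin.succAbove] <;> assumption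
    · intro f; simp [orientCoeff, Fin.sum_univ_three]; ring
  · refine key 2 0 1 1 (Or.inl rfl) h02 h12 ?_ ?_ ?_
    · simp [orientCoeff]
    · intro i; fin_cases i <;> simp [orientCoeff, Fin.succAbove] <;> assumption
    · intro f; simp [orientCoeff, Fin.sum_univ_three]; ring
  · refine key 0 2 1 (-1) (Or.inr rfl) h02 h01 ?_ ?_ ?_
    · simp [orientCoeff]
    · intro i; fin_cases i <;> simp [orientCoeff, Fin.succAbove] <;> assumption
    · intro f; simp [orientCoeff, Fin.sum_univ_three]; ring
  · refine key 0 1 2 1 (Or.inl rfl) h01 h02 ?_ ?_ ?_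
    · simp [orientCoeff]
    · intro i; fin_cases i <;> simp [orientCoeff, Fin.succAbove] <;> assumption
    · intro f; simp [orientCoeff, Fin.sum_univ_three]; ring
  · refine key 2 1 0 (-1) (Or.inr rfl) h12 h02 ?_ ?_ ?_
    · simp [orientCoeff]
    · intro i; fin_cases i <;> simp [orientCoeff, Fin.succAbove] <;> assumption
    · intro f; simp [orientCoeff, Fin.sum_univ_three]; ring
  · refine key 1 2 0 1 (Or.inl rfl) h12 h01 ?_ ?_ ?_
    · simp [orientCoeff]
    · intro i; fin_cases i <;> simp [orientCoeff, Fin.succAbove] <;> assumption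
    · intro f; simp [orientCoeff, Fin.sum_univ_three]; ring
  · refine key 1 2 0 1 (Or.inl rfl) h12 h01 ?_ ?_ ?_
    · simp [orientCoeff]
    · intro i; fin_cases i <;> simp [orientCoeff, Fin.succAbove] <;> assumption
    · intro f; simp [orientCoeff, Fin.sum_univ_three]; ring

section Comparison

variable {H : Set (ℝ × ℝ)}

/-- Concavity of the upper and convexity of the lower boundary bound the offset produced by the middle
ordinates by the offset produced by half the width. -/
theorem abs_sum_midOrdinate_le (hH : IsCCS H) {x : Fin 3 → ℝ}
    (hx : ∀ i, x i ∈ Set.Icc (xMin H) (xMax H)) :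
    2 * |∑ i, orientCoeff x i * midOrdinate H (x i)| ≤
      |∑ i, orientCoeff x i * width H (x i)| := by
  obtain ⟨m, ε, hε, -, -, hf, -⟩ := exists_dominant_coeff x
  have h1 := hf _ _ (concaveOn_yHigh hH) hx
  have h2 := hf _ _ (convexOn_yLow hH).neg hx
  have e1 : ∑ i, orientCoeff x i * midOrdinate H (x i) =
      (∑ i, orientCoeff x i * yHigh H (x i) - ∑ i, orientCoeff x i * (-yLow H) (x i)) / 2 := by
    rw [← Finset.sum_sub_distrib, Finset.sum_div]
    refine Finset.sum_congr rfl fun i _ => ?_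
    rw [midOrdinate_of_mem (hx i), Pi.neg_apply]; ring
  have e2 : ∑ i, orientCoeff x i * width H (x i) =
      ∑ i, orientCoeff x i * yHigh H (x i) + ∑ i, orientCoeff x i * (-yLow H) (x i) := by
    rw [← Finset.sum_add_distrib]
    refine Finset.sum_congr rfl fun i _ => ?_
    rw [width_of_mem (hx i), Pi.neg_apply]; ring
  rw [e1, e2]
  generalize ∑ i, orientCoeff x i * yHigh H (x i) = s at *
  generalize ∑ i, orientCoeff x i * (-yLow H) (x i) = t at *
  rcases hε with rfl | rfl
  · rw [abs_of_nonneg (by linarith : 0 ≤ s + t)]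
    have : |(s - t) / 2| ≤ (s + t) / 2 := abs_le.2 ⟨by linarith, by linarith⟩
    linarith
  · rw [abs_of_nonpos (by linarith : s + t ≤ 0)]
    have : |(s - t) / 2| ≤ -(s + t) / 2 := abs_le.2 ⟨by linarith, by linarith⟩
    linarith

/-- The comparison for fixed abscissas. -/
theorem integral_absSubSq_orient_shear_mono (hH : IsCCS H) {κ : ℝ} (hκ0 : 0 ≤ κ)
    (hκ : κ * (2 * volume.real H) ≤ 1) {x : Fin 3 → ℝ}
    (hx : ∀ i, x i ∈ Set.Icc (xMin H) (xMax H)) {c c' : ℝ → ℝ}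
    (hcc : |∑ i, orientCoeff x i * c (x i)| ≤ |∑ i, orientCoeff x i * c' (x i)|)
    (hc' : 2 * |∑ i, orientCoeff x i * c' (x i)| ≤ |∑ i, orientCoeff x i * width H (x i)|) :
    ∫ v, absSubSq κ (∑ i, orientCoeff x i * v i + ∑ i, orientCoeff x i * c (x i))
        ∂(Measure.pi fun i => centeredVolume (width H (x i))) ≤
      ∫ v, absSubSq κ (∑ i, orientCoeff x i * v i + ∑ i, orientCoeff x i * c' (x i))
        ∂(Measure.pi fun i => centeredVolume (width H (x i))) := by
  obtain ⟨m, ε, hε, hm, hi, hf, p, q, hpm, hmq, hpq⟩ := exists_dominant_coeff x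
  have hL := hf _ _ (concaveOn_width hH) hx
  have habs1 : |ε| = 1 := by rcases hε with rfl | rfl <;> simp
  have ham : |orientCoeff x m| = ε * orientCoeff x m := by
    rw [← abs_of_nonneg hm, abs_mul, habs1, one_mul]
  have hai : ∀ i : Fin 2, |orientCoeff x (m.succAbove i)| =
      -(ε * orientCoeff x (m.succAbove i)) := fun i => by
    rw [← abs_of_nonpos (hi i), abs_mul, habs1, one_mul]
  have hW : |∑ i, orientCoeff x i * width H (x i)| =
      ε * ∑ i, orientCoeff x i * width H (x i) := by
    rw [← abs_of_nonneg hL, abs_mul, habs1, one_mul]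
  refine integral_pi_absSubSq_mono (n := 2) (orientCoeff x) (fun i => width H (x i))
    (fun i => width_nonneg hH _) m ?_ hcc ?_
  · rw [ham, hpq]
    exact (mul_le_mul_of_nonneg_left (sub_mul_width_le hH hpm hmq (hx p) (hx q)) hκ0).trans hκ
  · rw [hW, Fin.sum_univ_succAbove (fun i => orientCoeff x i * width H (x i)) m, mul_add,
      Finset.mul_sum] at hc'
    have : ∑ i : Fin 2, |orientCoeff x (m.succAbove i)| * width H (x (m.succAbove i)) =
        -∑ i : Fin 2, ε * (orientCoeff x (m.succAbove i) * width H (x (m.succAbove i))) := by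
      rw [← Finset.sum_neg_distrib]
      exact Finset.sum_congr rfl fun i _ => by rw [hai]; ring
    rw [this, ham]
    linarith

/-- Two sets which a shear maps onto the Steiner symmetrization of `H` are compared through the
offsets which the shears give to three points with given abscissas. -/
theorem integral_absSubSq_orient_mono (hH : IsCCS H) {κ : ℝ} (hκ0 : 0 ≤ κ)
    (hκ : κ * (2 * volume.real H) ≤ 1) {K K' : Set (ℝ × ℝ)} {c c' : ℝ → ℝ} (hc : Measurable c)
    (hc' : Measurable c') (hK : MeasurableSet K) (hK' : MeasurableSet K') (hKc : Convex ℝ K)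
    (hKc' : Convex ℝ K') (h0 : volume (steinerSymm H) ≠ 0) (htop : volume (steinerSymm H) ≠ ⊤)
    (hS : shear c ⁻¹' K = steinerSymm H) (hS' : shear c' ⁻¹' K' = steinerSymm H)
    (hcc : ∀ x : Fin 3 → ℝ, (∀ i, x i ∈ Set.Icc (xMin H) (xMax H)) →
      |∑ i, orientCoeff x i * c (x i)| ≤ |∑ i, orientCoeff x i * c' (x i)|)
    (hcw : ∀ x : Fin 3 → ℝ, (∀ i, x i ∈ Set.Icc (xMin H) (xMax H)) →
      2 * |∑ i, orientCoeff x i * c' (x i)| ≤ |∑ i, orientCoeff x i * width H (x i)|) :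
    ∫ t, absSubSq κ (orient (t 0) (t 1) (t 2)) ∂(uniformLaw K 3) ≤
      ∫ t, absSubSq κ (orient (t 0) (t 1) (t 2)) ∂(uniformLaw K' 3) := by
  have pull : ∀ {L : Set (ℝ × ℝ)} {g : ℝ → ℝ}, Measurable g → MeasurableSet L → Convex ℝ L →
      shear g ⁻¹' L = steinerSymm H →
      (∫ t, absSubSq κ (orient (t 0) (t 1) (t 2)) ∂(uniformLaw L 3) =
        ∫ t, absSubSq κ (orient (shear g (t 0)) (shear g (t 1)) (shear g (t 2)))
          ∂(uniformLaw (steinerSymm H) 3)) ∧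
      Integrable (fun t : Fin 3 → ℝ × ℝ =>
        absSubSq κ (orient (shear g (t 0)) (shear g (t 1)) (shear g (t 2))))
          (uniformLaw (steinerSymm H) 3) := by
    intro L g hg hL hLc hSL
    have hvol : volume (steinerSymm H) = volume L := by
      rw [← hSL]; exact (measurePreserving_shear hg).measure_preimage hL.nullMeasurableSet
    have := isProbabilityMeasure_cond_volume h0 htop
    have := isProbabilityMeasure_cond_volume (hvol ▸ h0) (hvol ▸ htop)
    have hmp : MeasurePreserving (fun (t : Fin 3 → ℝ × ℝ) i => shear g (t i))
        (uniformLaw (steinerSymm H) 3) (uniformLaw L 3) :=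
      measurePreserving_pi _ _ fun _ => measurePreserving_shear_cond hg hL hSL
    have hint := integrable_absSubSq_orient hL hLc (hvol ▸ h0) (hvol ▸ htop) κ
    refine ⟨?_, hmp.integrable_comp_of_integrable hint⟩
    rw [← hmp.map_eq, integral_map hmp.measurable.aemeasurable]
    rw [hmp.map_eq]
    exact hint.aestronglyMeasurable
  obtain ⟨e, hi⟩ := pull hc hK hKc hS
  obtain ⟨e', hi'⟩ := pull hc' hK' hKc' hS'
  rw [e, e', ← sub_nonneg, ← integral_sub hi' hi]
  refine integral_uniformLaw_steinerSymm_nonneg hH h0 htop (hi'.sub hi) fun x hx => ?_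
  have hcont : ∀ d : ℝ, Integrable (fun v : Fin 3 → ℝ =>
      absSubSq κ (∑ i, orientCoeff x i * v i + d))
      (Measure.pi fun i => centeredVolume (width H (x i))) := fun d =>
    integrable_pi_centeredVolume _ ((continuous_absSubSq κ).comp (by fun_prop))
  simp only [orient_shear]
  have := integral_absSubSq_orient_shear_mono hH hκ0 hκ hx (hcc x hx) (hcw x hx)
  rw [← sub_nonneg, ← integral_sub (hcont _) (hcont _)] at this
  exact this

theorem shear_midOrdinate_preimage (hH : IsCCS H) :
    shear (midOrdinate H) ⁻¹' H = steinerSymm H := by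
  ext ⟨x, v⟩
  constructor
  · intro h
    have hx := fst_mem_Icc hH h
    have h' := (mem_iff_of_mem_Icc hH hx _).1 h
    simp only [shear] at hx h'
    rw [midOrdinate_of_mem hx] at h'
    refine ⟨hx.1, hx.2, ?_⟩
    rw [width_of_mem hx, abs_le]
    constructor <;> simp only <;> linarith
  · rintro ⟨h1, h2, h3⟩
    have hx : x ∈ Set.Icc (xMin H) (xMax H) := ⟨h1, h2⟩
    simp only at h3
    rw [width_of_mem hx, abs_le] at h3
    change (x, v + midOrdinate H x) ∈ H
    rw [mem_iff_of_mem_Icc hH hx, midOrdinate_of_mem hx]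
    constructor <;> linarith

theorem shear_half_width_preimage :
    shear (fun x => width H x / 2) ⁻¹' shaking H = steinerSymm H := by
  ext ⟨x, v⟩
  simp only [Set.mem_preimage, shear, shaking, steinerSymm, Set.mem_ofPred_eq, abs_le]
  refine and_congr_right fun _ => and_congr_right fun _ => ?_
  constructor <;> rintro ⟨h1, h2⟩ <;> constructor <;> linarith

theorem shear_zero_preimage (K : Set (ℝ × ℝ)) : shear (fun _ => 0) ⁻¹' K = K := by
  ext p; simp [shear]

end Comparison

theorem theorem3 (H : Set (ℝ × ℝ)) (hH : IsCCS H) (n : ℕ) (hn : n = 4 ∨ n = 5) :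
    Q n (steinerSymm H) ≥ Q n H ∧ Q n (shaking H) ≤ Q n H := by
  have hHm : MeasurableSet H := hH.1.measurableSet
  have hHc := hH.2.1
  have hSm := measurableSet_steinerSymm hH
  have hSc := convex_steinerSymm hH
  have hTm := measurableSet_shaking hH
  have hTc := convex_shaking hH
  have hmid := measurable_midOrdinate hH
  have hhalf : Measurable fun x => width H x / 2 := (measurable_width hH).div_const 2
  have hvH : volume (steinerSymm H) = volume H := by
    rw [← shear_midOrdinate_preimage hH]
    exact (measurePreserving_shear hmid).measure_preimage hHm.nullMeasurableSet
  have hvT : volume (steinerSymm H) = volume (shaking H) := by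
    rw [← shear_half_width_preimage]
    exact (measurePreserving_shear hhalf).measure_preimage hTm.nullMeasurableSet
  have hH0 : volume H ≠ 0 := fun h =>
    (isOpen_interior.measure_pos volume hH.2.2).ne' (measure_mono_null interior_subset h)
  have hHt : volume H ≠ ⊤ := hH.1.measure_lt_top.ne
  have hS0 : volume (steinerSymm H) ≠ 0 := hvH ▸ hH0
  have hSt : volume (steinerSymm H) ≠ ⊤ := hvH ▸ hHt
  have hT0 : volume (shaking H) ≠ 0 := hvT ▸ hS0
  have hTt : volume (shaking H) ≠ ⊤ := hvT ▸ hSt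
  have hrS : volume.real (steinerSymm H) = volume.real H := by rw [Measure.real, hvH]; rfl
  have hrT : volume.real (shaking H) = volume.real H := by rw [Measure.real, ← hvT, hvH]; rfl
  have hA := volume_real_pos hH0 hHt
  have hwhalf : ∀ x : Fin 3 → ℝ, 2 * |∑ i, orientCoeff x i * (width H (x i) / 2)| =
      |∑ i, orientCoeff x i * width H (x i)| := fun x => by
    have : ∑ i, orientCoeff x i * (width H (x i) / 2) =
        (∑ i, orientCoeff x i * width H (x i)) / 2 := by
      rw [Finset.sum_div]; exact Finset.sum_congr rfl fun i _ => by ring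
    rw [this, abs_div, abs_two]; ring
  have hsymm : ∀ {κ : ℝ}, 0 ≤ κ → κ * (2 * volume.real H) ≤ 1 →
      ∫ t, absSubSq κ (orient (t 0) (t 1) (t 2)) ∂(uniformLaw (steinerSymm H) 3) ≤
        ∫ t, absSubSq κ (orient (t 0) (t 1) (t 2)) ∂(uniformLaw H 3) := fun h1 h2 =>
    integral_absSubSq_orient_mono hH h1 h2 measurable_const hmid hSm hHm hSc hHc hS0 hSt
      (shear_zero_preimage _) (shear_midOrdinate_preimage hH) (fun x hx => by simp)
      (fun x hx => abs_sum_midOrdinate_le hH hx)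
  have hshak : ∀ {κ : ℝ}, 0 ≤ κ → κ * (2 * volume.real H) ≤ 1 →
      ∫ t, absSubSq κ (orient (t 0) (t 1) (t 2)) ∂(uniformLaw H 3) ≤
        ∫ t, absSubSq κ (orient (t 0) (t 1) (t 2)) ∂(uniformLaw (shaking H) 3) := fun h1 h2 =>
    integral_absSubSq_orient_mono hH h1 h2 hmid hhalf hHm hTm hHc hTc hS0 hSt
      (shear_midOrdinate_preimage hH) shear_half_width_preimage
      (fun x hx => by linarith [abs_sum_midOrdinate_le hH hx, hwhalf x])
      (fun x hx => (hwhalf x).le)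
  rcases hn with rfl | rfl
  · rw [Q_four_eq hSm hSc hS0 hSt, Q_four_eq hHm hHc hH0 hHt, Q_four_eq hTm hTc hT0 hTt, hrS, hrT]
    have h1 := hsymm le_rfl (by simp)
    have h2 := hshak le_rfl (by simp)
    constructor <;> gcongr
  · rw [Q_five_eq hSm hSc hS0 hSt, Q_five_eq hHm hHc hH0 hHt, Q_five_eq hTm hTc hT0 hTt, hrS, hrT]
    have hκ : 1 / (2 * volume.real H) * (2 * volume.real H) ≤ 1 := by
      rw [one_div, inv_mul_cancel₀ (by positivity)]
    have h1 := hsymm (by positivity) hκ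
    have h2 := hshak (by positivity) hκ
    constructor <;> gcongr
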